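/- Encode an $n$-vertex tournament on $[n]$ as a string $T\in\{0,1\}^{\binom n2}$ with one bit per pair $\{i,j\}$, $i\neq j$, giving the direction of the edge between $i$ and $j$. Let $d^+(v)$ be the out-degree of $v$ in $T$, and let $\mathsf{MOD}_n\subseteq\{0,1\}^{\binom n2}\times[n]$ be the set of pairs $(T,v)$ with $d^+(v)\ge d^+(w)$ for all $w\in[n]$. For a relation $f\subseteq\{0,1\}^m\times\mathcal R$, a quantum query algorithm with $t$ queries starts in an input-independent unit vector $|\psi_0\rangle$ of a finite-dimensional space with basis $|i\rangle|b\rangle|w\rangle$ ($i\in\{0,1,\dots,m\}$, $b\in\{0,1\}$, $w$ in an arbitrary finite workspace), applies $U_0,O_x,U_1,O_x,\dots,O_x,U_t$ with $t$ applications of $O_x$, where the unitaries $U_j$ do not depend on the input $x$ and $O_x|i\rangle|b\rangle|w\rangle=|i\rangle|b\oplus x_i\rangle|w\rangle$ for $i\ge1$, $O_x|0\rangle|b\rangle|w\rangle=|0\rangle|b\rangle|w\rangle$, then measures in the computational basis and outputs an element of $\mathcal R$ that is a fixed function of the outcome. The bounded-error quantum query complexity $\mathsf Q(f)$ is the least $t$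 for which some such algorithm outputs, on every input $x\in\{0,1\}^m$, with probability at least $2/3$ an element $r$ with $(x,r)\in f$. Theorem. $\mathsf Q(\mathsf{MOD}_n)=O(n^{3/2})$ and $\mathsf Q(\mathsf{MOD}_n)=\Omega(n)$. That is, there are absolute constants $c,C>0$ such that $\mathsf Q(\mathsf{MOD}_n)\le C\,n^{3/2}$ for all integers $n\ge1$, and $\mathsf Q(\mathsf{MOD}_n)\ge c\,n$ for all integers $n\ge2$. -/

import Mathlib

open scoped ENNReal NNReal

noncomputable section

namespace QuantumQuery

/-- Labels of the computational basis: a query index (`none` is the index `0`, at which nothing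
is queried), a query bit, and a basis label of the workspace. -/
abbrev BasisLabel (ι W : Type) : Type := Option ι × Bool × W

/-- The finite-dimensional Hilbert space on which a query algorithm acts. -/
abbrev StateSpace (ι W : Type) [Fintype ι] [Fintype W] : Type :=
  EuclideanSpace ℂ (BasisLabel ι W)

/-- The action of a query to `x` on the basis labels: `(i, b, w) ↦ (i, b ⊕ xᵢ, w)`, and
`(0, b, w) ↦ (0, b, w)`. -/
def queryFun {ι W : Type} (x : ι → Bool) : BasisLabel ι W → BasisLabel ι W
  | (none, b, w) => (none, b, w)
  | (some i, b, w) => (some i, xor b (x i), w)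

theorem queryFun_involutive {ι W : Type} (x : ι → Bool) :
    Function.Involutive (queryFun (W := W) x) := by
  rintro ⟨_ | i, b, w⟩
  · rfl
  · simp [queryFun]

/-- The query unitary `O_x`, which permutes the computational basis by `queryFun x`. -/
def oracle {ι W : Type} [Fintype ι] [Fintype W] (x : ι → Bool) :
    StateSpace ι W ≃ₗᵢ[ℂ] StateSpace ι W :=
  LinearIsometryEquiv.piLpCongrLeft 2 ℂ ℂ (queryFun_involutive x).toPerm

/-- A quantum query algorithm with query access to a string in `ι → Bool`, outputs in `R` and a
finite workspace: an input-independent unit initial state, input-independent unitaries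
`U 0, U 1, …`, and a classical output for each outcome of the final measurement in the
computational basis. A run with `T` queries uses only `U 0, …, U T`. -/
structure Algorithm (ι R W : Type) [Fintype ι] [Fintype W] where
  init : StateSpace ι W
  norm_init : ‖init‖ = 1
  U : ℕ → (StateSpace ι W ≃ₗᵢ[ℂ] StateSpace ι W)
  out : BasisLabel ι W → R

/-- The state `U_T O_x U_{T-1} O_x ⋯ O_x U_0 |ψ₀⟩` after `T` queries to `x`. -/
def Algorithm.state {ι R W : Type} [Fintype ι] [Fintype W] (A : Algorithm ι R W) (x : ι → Bool) :
    ℕ → StateSpace ι W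
  | 0 => A.U 0 A.init
  | T + 1 => A.U (T + 1) (oracle x (A.state x T))

open Classical in
/-- The probability that the algorithm, run with `T` queries on input `x`, outputs some `r` in
the set `S`. -/
def Algorithm.outputProb {ι R W : Type} [Fintype ι] [Fintype W] (A : Algorithm ι R W)
    (T : ℕ) (x : ι → Bool) (S : Set R) : ℝ :=
  ∑ s : BasisLabel ι W, if A.out s ∈ S then ‖A.state x T s‖ ^ 2 else 0

/-- Some quantum algorithm with `T` queries computes the relation `f` with error at most `1/3` on
every input. -/
def ComputableWith {ι R : Type} [Fintype ι] (f : (ι → Bool) → R → Prop) (T : ℕ) : Prop :=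
  ∃ (W : Type) (_ : Fintype W) (A : Algorithm ι R W),
    ∀ x : ι → Bool, 2 / 3 ≤ A.outputProb T x {r | f x r}

/-- The bounded-error quantum query complexity `Q(f)` of the relation `f` (`⊤` if no algorithm
computes `f`). -/
def Q {ι R : Type} [Fintype ι] (f : (ι → Bool) → R → Prop) : ℕ∞ :=
  ⨅ (T : ℕ) (_ : ComputableWith f T), (T : ℕ∞)

end QuantumQuery

namespace Tournament

/-- The `n.choose 2` edges of the complete graph on `Fin n`: the pairs `i < j`. -/
abbrev Edge (n : ℕ) : Type := {p : Fin n × Fin n // p.1 < p.2}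

/-- `Arc T u v`: the edge between `u` and `v` is directed `u → v` in the tournament described by
the bit string `T`, where the bit of a pair `i < j` is `true` if `i → j` and `false` if `j → i`. -/
def Arc {n : ℕ} (T : Edge n → Bool) (u v : Fin n) : Prop :=
  (∃ h : u < v, T ⟨(u, v), h⟩ = true) ∨ (∃ h : v < u, T ⟨(v, u), h⟩ = false)

open Classical in
/-- The out-degree `d⁺(v)`. -/
def outDegree {n : ℕ} (T : Edge n → Bool) (v : Fin n) : ℕ :=
  (Finset.univ.filter fun u => Arc T v u).card

/-- The relation `MOD_n`: `v` is a vertex of maximum out-degree in `T`. -/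
def MOD (n : ℕ) (T : Edge n → Bool) (v : Fin n) : Prop :=
  ∀ w : Fin n, outDegree T w ≤ outDegree T v

end Tournament

end

/-! Lower bound. The hybrid method is applied to a nearly regular tournament in which every vertex
of the upper half has the maximum out-degree `n / 2`. Reversing a single edge inside the upper half,
so that its larger endpoint wins, makes that endpoint the unique maximum. There are of order `n ^ 2`
such edges, and most of them force an answer other than the one output that can be likely on the
unperturbed tournament. Each query has total weight at most `1` to spread over these edges, so all
of them can be noticed only if `T ^ 2` is of order `n ^ 2` (`ComputableWith.exists_card_le`,
`outDegree_update_lt`).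

Upper bound. This is quantum maximum finding over the `n` vertices, where evaluating one vertex
means reading its `n` potential edges. Stage `j` assumes that at most `n / 9 ^ j` vertices beat the
current threshold and runs Grover search with `2 * k + 1 = 3 ^ j`. At that length the rotation
cannot overshoot, so every better vertex has probability at least a constant times `9 ^ j / n`, and
one search reaches the next stage with constant probability (`exists_realizes_search`,
`le_sum_isGood_improve`). A stage with `t` stages to follow is repeated `32 * (t + 1)` times: the
failure probabilities form a geometric series, and the cost is dominated by the last stages, `O(√n)`
evaluations of `n` queries each. The adaptive classical procedure becomes one quantum algorithm by
deferring all measurements (`Realizes.bind`). -/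

open scoped ENNReal NNReal

noncomputable section

/-! ### The hybrid method -/

namespace QuantumQuery

variable {ι R W : Type} [Fintype ι] [Fintype W]

theorem oracle_apply (x : ι → Bool) (ψ : StateSpace ι W) (l : BasisLabel ι W) :
    oracle x ψ l = ψ (queryFun x l) := rfl

theorem Algorithm.norm_state (A : Algorithm ι R W) (x : ι → Bool) (T : ℕ) :
    ‖A.state x T‖ = 1 := by
  induction T with
  | zero => simp [Algorithm.state, A.norm_init]
  | succ T ih => simp [Algorithm.state, ih]

/-- The weight with which the state `ψ` queries the index `i`. -/
def queryWeight (i : ι) (ψ : StateSpace ι W) : ℝ := ∑ p : Bool × W, ‖ψ (some i, p)‖ ^ 2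

theorem queryWeight_nonneg (i : ι) (ψ : StateSpace ι W) : 0 ≤ queryWeight i ψ :=
  Finset.sum_nonneg fun _ _ => sq_nonneg _

theorem sum_queryWeight_le (S : Finset ι) (ψ : StateSpace ι W) :
    ∑ i ∈ S, queryWeight i ψ ≤ ‖ψ‖ ^ 2 := by
  calc ∑ i ∈ S, queryWeight i ψ ≤ ∑ i, queryWeight i ψ :=
        Finset.sum_le_univ_sum_of_nonneg fun i => queryWeight_nonneg i ψ
    _ ≤ ‖ψ‖ ^ 2 := by
        rw [EuclideanSpace.norm_sq_eq, Fintype.sum_prod_type, Fintype.sum_option]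
        simp only [queryWeight]
        linarith [Finset.sum_nonneg fun (p : Bool × W) (_ : p ∈ Finset.univ) =>
          sq_nonneg ‖ψ (none, p)‖]

/-- Only the block with query index `i` is affected, where the two oracles differ at most by
exchanging the amplitudes `a`, `b` of the two query bits; then `2 * ‖a - b‖ ^ 2 ≤ 4 * (‖a‖ ^ 2 + ‖b‖
^ 2)`. -/
theorem norm_oracle_sub_oracle_sq_le {x y : ι → Bool} {i : ι} (h : ∀ j, j ≠ i → x j = y j)
    (ψ : StateSpace ι W) : ‖oracle x ψ - oracle y ψ‖ ^ 2 ≤ 4 * queryWeight i ψ := by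
  classical
  rw [EuclideanSpace.norm_sq_eq, Fintype.sum_prod_type, Fintype.sum_option]
  have h0 : ∀ p : Bool × W, (oracle x ψ - oracle y ψ) (none, p) = 0 := fun p => by
    simp [oracle_apply, queryFun]
  have h1 : ∀ j, j ≠ i → ∀ p : Bool × W, (oracle x ψ - oracle y ψ) (some j, p) = 0 :=
    fun j hj p => by simp [oracle_apply, queryFun, h j hj]
  rw [Finset.sum_eq_single i (fun j _ hj => by simp [h1 j hj]) (by simp)]
  simp only [h0, norm_zero, queryWeight, Fintype.sum_prod_type, Fintype.sum_bool]
  simp only [← Finset.sum_add_distrib, Finset.mul_sum]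
  norm_num
  refine Finset.sum_le_sum fun w _ => ?_
  simp only [oracle_apply, queryFun]
  set a := ψ (some i, true, w)
  set b := ψ (some i, false, w)
  have hab : ‖a - b‖ ^ 2 ≤ 2 * (‖a‖ ^ 2 + ‖b‖ ^ 2) := by
    nlinarith [norm_sub_le a b, norm_nonneg (a - b), sq_nonneg (‖a‖ - ‖b‖), norm_nonneg a,
      norm_nonneg b]
  have hba : ‖b - a‖ ^ 2 ≤ 2 * (‖a‖ ^ 2 + ‖b‖ ^ 2) := by rwa [norm_sub_rev]
  cases x i <;> cases y i <;> simp <;> nlinarith [sq_nonneg ‖a‖, sq_nonneg ‖b‖]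

theorem Algorithm.norm_state_sub_le (A : Algorithm ι R W) {x y : ι → Bool} {i : ι}
    (h : ∀ j, j ≠ i → y j = x j) (T : ℕ) :
    ‖A.state y T - A.state x T‖ ≤
      ∑ t ∈ Finset.range T, 2 * √(queryWeight i (A.state x t)) := by
  induction T with
  | zero => simp [Algorithm.state]
  | succ T ih =>
    rw [Finset.sum_range_succ]
    simp only [Algorithm.state, ← map_sub, LinearIsometryEquiv.norm_map]
    have h1 : oracle y (A.state y T) - oracle x (A.state x T) =
        oracle y (A.state y T - A.state x T) +
          (oracle y (A.state x T) - oracle x (A.state x T)) := by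
      rw [map_sub]; abel
    have h2 : ‖oracle y (A.state x T) - oracle x (A.state x T)‖ ≤
        2 * √(queryWeight i (A.state x T)) := by
      refine abs_le_of_sq_le_sq' ?_ (by positivity) |>.2
      rw [mul_pow, Real.sq_sqrt (queryWeight_nonneg _ _)]
      linarith [norm_oracle_sub_oracle_sq_le h (A.state x T)]
    rw [h1]
    refine (norm_add_le _ _).trans (add_le_add ?_ h2)
    rwa [LinearIsometryEquiv.norm_map]

/-- The hybrid bound: over inputs that differ from `x` in one position each, the squared distances
of the final states from the one on `x` add up to at most `4 T ^ 2`. -/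
theorem Algorithm.sum_norm_state_sub_sq_le (A : Algorithm ι R W) (x : ι → Bool)
    (y : ι → ι → Bool) (S : Finset ι) (h : ∀ i ∈ S, ∀ j, j ≠ i → y i j = x j) (T : ℕ) :
    ∑ i ∈ S, ‖A.state (y i) T - A.state x T‖ ^ 2 ≤ 4 * (T : ℝ) ^ 2 := by
  have h1 : ∀ i ∈ S, ‖A.state (y i) T - A.state x T‖ ^ 2 ≤
      4 * T * ∑ t ∈ Finset.range T, queryWeight i (A.state x t) := by
    intro i hi
    have h2 := pow_le_pow_left₀ (norm_nonneg _) (A.norm_state_sub_le (h i hi) T) 2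
    refine h2.trans (sq_sum_le_card_mul_sum_sq.trans (le_of_eq ?_))
    simp only [mul_pow, Real.sq_sqrt (queryWeight_nonneg _ _), ← Finset.mul_sum,
      Finset.card_range]
    ring
  refine (Finset.sum_le_sum h1).trans ?_
  rw [← Finset.mul_sum, Finset.sum_comm]
  -- All weights are taken along the run on the fixed input `x`, so at each time the positions share
  -- a total weight of at most `1`.
  have h3 : ∀ t ∈ Finset.range T, ∑ i ∈ S, queryWeight i (A.state x t) ≤ 1 := fun t _ => by
    simpa [A.norm_state] using sum_queryWeight_le S (A.state x t)
  have h4 := Finset.sum_le_sum h3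
  simp only [Finset.sum_const, Finset.card_range, nsmul_eq_mul, mul_one] at h4
  nlinarith [Nat.cast_nonneg (α := ℝ) T]

/-- Expanding `(‖b‖ + δ) ^ 2` and using `2 * ‖b‖ * δ ≤ ‖b‖ ^ 2 / 6 + 6 * δ ^ 2`. The factor `7 / 6`
is small enough that `7 / 6 * (1 / 2)` stays below `2 / 3`. -/
theorem Algorithm.outputProb_le_add (A : Algorithm ι R W) (T : ℕ) (x y : ι → Bool) (S : Set R) :
    A.outputProb T y S ≤
      7 / 6 * A.outputProb T x S + 7 * ‖A.state y T - A.state x T‖ ^ 2 := by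
  classical
  rw [EuclideanSpace.norm_sq_eq, Algorithm.outputProb, Algorithm.outputProb, Finset.mul_sum,
    Finset.mul_sum, ← Finset.sum_add_distrib]
  refine Finset.sum_le_sum fun s _ => ?_
  split_ifs
  · simp only [PiLp.sub_apply]
    set a := A.state y T s
    set b := A.state x T s
    have : ‖a‖ ≤ ‖b‖ + ‖a - b‖ := by simpa using norm_add_le b (a - b)
    nlinarith [sq_nonneg (‖b‖ - 6 * ‖a - b‖), norm_nonneg a]
  · positivity

theorem Algorithm.outputProb_mono (A : Algorithm ι R W) (T : ℕ) (x : ι → Bool) {S S' : Set R}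
    (h : S ⊆ S') : A.outputProb T x S ≤ A.outputProb T x S' := by
  classical
  refine Finset.sum_le_sum fun s _ => ?_
  by_cases h1 : A.out s ∈ S
  · simp [h1, h h1]
  · simp only [h1, if_false]
    split_ifs <;> positivity

theorem Algorithm.outputProb_add_le_one (A : Algorithm ι R W) (T : ℕ) (x : ι → Bool)
    {S S' : Set R} (h : Disjoint S S') : A.outputProb T x S + A.outputProb T x S' ≤ 1 := by
  classical
  have h1 : ∑ s, ‖A.state x T s‖ ^ 2 = 1 := by
    rw [← EuclideanSpace.norm_sq_eq, A.norm_state, one_pow]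
  rw [← h1, Algorithm.outputProb, Algorithm.outputProb, ← Finset.sum_add_distrib]
  refine Finset.sum_le_sum fun s _ => ?_
  by_cases h2 : A.out s ∈ S
  · simp [h2, Set.disjoint_left.1 h h2]
  · simp only [h2, if_false, zero_add]
    split_ifs
    · exact le_rfl
    · positivity

theorem not_computableWith_zero {f : (ι → Bool) → R → Prop} {x y : ι → Bool} {a b : R}
    (hab : a ≠ b) (hx : ∀ r, f x r → r = a) (hy : ∀ r, f y r → r = b) :
    ¬ ComputableWith f 0 := by
  rintro ⟨W, _, A, hA⟩
  have h1 := (hA x).trans (A.outputProb_mono 0 x (S' := {a}) hx)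
  have h2 := (hA y).trans (A.outputProb_mono 0 y (S' := {b}) hy)
  have h3 := A.outputProb_add_le_one 0 x (Set.disjoint_singleton.2 hab)
  have h4 : A.outputProb 0 y {b} = A.outputProb 0 x {b} := rfl
  linarith

/-- If changing `x` in the position `i` forces the output `r i`, for all `i` in `S`, then a
`T`-query algorithm has `336 T ^ 2 ≥ |{i ∈ S | r i ≠ r₀}|` for some `r₀`. -/
theorem ComputableWith.exists_card_le {f : (ι → Bool) → R → Prop} {T : ℕ}
    (hf : ComputableWith f T) [DecidableEq R] [Nonempty R] (x : ι → Bool) (y : ι → ι → Bool)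
    (S : Finset ι) (r : ι → R)
    (hy : ∀ i ∈ S, ∀ j, j ≠ i → y i j = x j) (hr : ∀ i ∈ S, ∀ s, f (y i) s → s = r i) :
    ∃ r₀ : R, ((S.filter fun i => r i ≠ r₀).card : ℝ) ≤ 336 * (T : ℝ) ^ 2 := by
  obtain ⟨W, _, A, hA⟩ := hf
  -- At most one output has probability above `1 / 2` on `x`; if there is none, any `r₀` serves.
  obtain ⟨r₀, hr₀⟩ : ∃ r₀ : R, ∀ s, s ≠ r₀ → A.outputProb T x {s} ≤ 1 / 2 := by
    by_cases h : ∃ r₀ : R, 1 / 2 < A.outputProb T x {r₀}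
    · obtain ⟨r₀, h₀⟩ := h
      refine ⟨r₀, fun s hs => ?_⟩
      have := A.outputProb_add_le_one T x (Set.disjoint_singleton.2 hs)
      linarith
    · push Not at h
      exact ⟨Classical.arbitrary R, fun s _ => h s⟩
  refine ⟨r₀, ?_⟩
  have h1 := A.sum_norm_state_sub_sq_le x y (S.filter fun i => r i ≠ r₀)
    (fun i hi => hy i (Finset.mem_filter.1 hi).1) T
  -- The output `r i` must rise from at most `1 / 2` to at least `2 / 3`: `2 / 3 - 7 / 12 = 1 / 12 =
  -- 7 / 84`. Then `336 = 4 * 84`.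
  have h2 : ∀ i ∈ S.filter (fun i => r i ≠ r₀),
      (1 / 84 : ℝ) ≤ ‖A.state (y i) T - A.state x T‖ ^ 2 := by
    intro i hi
    obtain ⟨hi, hri⟩ := Finset.mem_filter.1 hi
    have h3 := (hA (y i)).trans (A.outputProb_mono T (y i) (S' := {r i}) (hr i hi))
    have h4 := A.outputProb_le_add T x (y i) {r i}
    have h5 := hr₀ _ hri
    linarith
  have h3 := Finset.sum_le_sum h2
  simp only [Finset.sum_const, nsmul_eq_mul] at h3
  linarith

end QuantumQuery

/-! ### From query counts to `Q` -/

namespace QuantumQuery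

theorem Q_le {ι R : Type} [Fintype ι] {f : (ι → Bool) → R → Prop} {T : ℕ}
    (h : ComputableWith f T) : Q f ≤ T :=
  iInf₂_le T h

theorem le_Q_of_forall {ι R : Type} [Fintype ι] {f : (ι → Bool) → R → Prop} {c : ℝ≥0} {n : ℕ}
    (h : ∀ T, ComputableWith f T → (c : ℝ) * n ≤ T) : (c : ℝ≥0∞) * n ≤ (Q f : ℝ≥0∞) := by
  classical
  by_cases hf : ∃ T, ComputableWith f T
  · have h1 : Q f = (Nat.find hf : ℕ∞) :=
      le_antisymm (Q_le (Nat.find_spec hf))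
        (le_iInf₂ fun T hT => by exact_mod_cast Nat.find_min' hf hT)
    rw [h1]
    have h2 : c * (n : ℝ≥0) ≤ (Nat.find hf : ℝ≥0) := by exact_mod_cast h _ (Nat.find_spec hf)
    simpa using (ENNReal.coe_le_coe.2 h2)
  · push Not at hf
    have h1 : Q f = ⊤ := by simp [Q, hf]
    simp [h1]

end QuantumQuery

/-! ### The lower bound: a sensitive tournament -/

namespace Tournament

theorem arc_of_lt {n : ℕ} (T : Edge n → Bool) {u v : Fin n} (h : u < v) :
    Arc T u v ↔ T ⟨(u, v), h⟩ = true := by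
  simp [Arc, h, h.not_gt]

theorem arc_of_gt {n : ℕ} (T : Edge n → Bool) {u v : Fin n} (h : v < u) :
    Arc T u v ↔ T ⟨(v, u), h⟩ = false := by
  simp [Arc, h, h.not_gt]

theorem not_arc_self {n : ℕ} (T : Edge n → Bool) (u : Fin n) : ¬ Arc T u u := by
  simp [Arc]

theorem eq_of_MOD {n : ℕ} {T : Edge n → Bool} {v r : Fin n}
    (hv : ∀ w, w ≠ v → outDegree T w < outDegree T v) (hr : MOD n T r) : r = v := by
  by_contra h
  exact absurd (hr v) (not_le.2 (hv r h))

theorem outDegree_lt_of_forall_arc {n : ℕ} {T : Edge n → Bool} {v : Fin n}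
    (hv : ∀ u, u ≠ v → Arc T v u) {w : Fin n} (hw : w ≠ v) : outDegree T w < outDegree T v := by
  classical
  have h1 : outDegree T v = n - 1 := by
    have : (Finset.univ.filter fun u => Arc T v u) = Finset.univ.erase v := by
      ext u
      by_cases h : u = v
      · simp [h, not_arc_self]
      · simp [h, hv u h]
    rw [outDegree, this]; simp
  have hwv : ¬ Arc T w v := by
    have := hv w hw
    rcases lt_or_gt_of_ne hw with h | h
    · rw [arc_of_gt T h] at this; rw [arc_of_lt T h]; simp [this]
    · rw [arc_of_lt T h] at this; rw [arc_of_gt T h]; simp [this]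
  have h2 : (Finset.univ.filter fun u => Arc T w u) ⊆ (Finset.univ.erase v).erase w := by
    intro u hu
    simp only [Finset.mem_filter, Finset.mem_univ, true_and] at hu
    refine Finset.mem_erase.2 ⟨?_, Finset.mem_erase.2 ⟨?_, Finset.mem_univ _⟩⟩
    · rintro rfl; exact not_arc_self T _ hu
    · rintro rfl; exact hwv hu
  have h3 := Finset.card_le_card h2
  rw [Finset.card_erase_of_mem (by simp [hw]), Finset.card_erase_of_mem (by simp)] at h3
  simp only [Finset.card_univ, Fintype.card_fin] at h3
  have : 2 ≤ n := by
    have := w.2; have := v.2; have := Fin.val_ne_of_ne hw; omega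
  rw [h1]
  exact lt_of_le_of_lt h3 (by omega)

/-- The two constant strings are transitive tournaments with different sources. This supplies `1 ≤
T`, which settles small `n`. -/
theorem not_computableWith_zero_MOD {n : ℕ} (hn : 2 ≤ n) :
    ¬ QuantumQuery.ComputableWith (MOD n) 0 := by
  refine QuantumQuery.not_computableWith_zero (x := fun _ => true) (y := fun _ => false)
    (a := ⟨0, by omega⟩) (b := ⟨n - 1, by omega⟩) (by simp; omega) ?_ ?_
  · refine fun r hr => eq_of_MOD (fun w hw => outDegree_lt_of_forall_arc (fun u hu => ?_) hw) hr
    have h : (⟨0, by omega⟩ : Fin n) < u := by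
      rw [Fin.lt_def]; have := Fin.val_ne_of_ne hu; simp at this ⊢; omega
    rw [arc_of_lt _ h]
  · refine fun r hr => eq_of_MOD (fun w hw => outDegree_lt_of_forall_arc (fun u hu => ?_) hw) hr
    have h : u < (⟨n - 1, by omega⟩ : Fin n) := by
      rw [Fin.lt_def]; have := Fin.val_ne_of_ne hu; have := u.2; simp at *; omega
    rw [arc_of_gt _ h]

/-- The (nearly) regular tournament in which `i → j`, for `i < j`, if and only if
`j - i ≤ (n - 1) / 2`. -/
def cyclic (n : ℕ) (e : Edge n) : Bool := decide ((e.1.2 : ℕ) - e.1.1 ≤ (n - 1) / 2)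

/-- A vertex beats the next `k = (n - 1) / 2` vertices, as far as they exist, and the `w - k`
vertices lying more than `k` below it. -/
theorem outDegree_cyclic_le {n : ℕ} (w : Fin n) : outDegree (cyclic n) w ≤ n / 2 := by
  classical
  have hw := w.2
  set k := (n - 1) / 2 with hk
  have h1 : (Finset.univ.filter fun u => Arc (cyclic n) w u).image Fin.val ⊆
      Finset.Ioc (w : ℕ) (min (w + k) (n - 1)) ∪ Finset.range (w - k) := by
    intro a ha
    obtain ⟨u, hu, rfl⟩ := Finset.mem_image.1 ha
    replace hu : Arc (cyclic n) w u := by simpa using hu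
    have hu2 := u.2
    simp only [Finset.mem_union, Finset.mem_Ioc, Finset.mem_range]
    rcases lt_trichotomy w u with h | h | h
    · rw [arc_of_lt _ h] at hu
      simp only [cyclic, decide_eq_true_eq, ← hk] at hu
      rw [Fin.lt_def] at h
      left; omega
    · exact absurd hu (h ▸ not_arc_self _ _)
    · rw [arc_of_gt _ h] at hu
      simp only [cyclic, decide_eq_false_iff_not, ← hk] at hu
      right; omega
  have h2 := (Finset.card_le_card h1).trans (Finset.card_union_le _ _)
  rw [Finset.card_image_of_injective _ Fin.val_injective, Nat.card_Ioc, Finset.card_range] at h2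
  refine le_trans h2 ?_
  omega

theorem le_outDegree_cyclic {n : ℕ} {w : Fin n} (h : (n - 1) / 2 < (w : ℕ)) :
    n / 2 ≤ outDegree (cyclic n) w := by
  classical
  have hw := w.2
  set k := (n - 1) / 2 with hk
  have h1 : Finset.Ioo (w : ℕ) n ∪ Finset.range (w - k) ⊆
      (Finset.univ.filter fun u => Arc (cyclic n) w u).image Fin.val := by
    intro a ha
    simp only [Finset.mem_union, Finset.mem_Ioo, Finset.mem_range] at ha
    have han : a < n := by omega
    refine Finset.mem_image.2 ⟨⟨a, han⟩, ?_, rfl⟩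
    simp only [Finset.mem_filter, Finset.mem_univ, true_and]
    rcases ha with ha | ha
    · rw [arc_of_lt _ (show w < ⟨a, han⟩ from ha.1)]
      simp only [cyclic, decide_eq_true_eq, ← hk]; omega
    · rw [arc_of_gt _ (show (⟨a, han⟩ : Fin n) < w from (by rw [Fin.lt_def]; simp; omega))]
      simp only [cyclic, decide_eq_false_iff_not, ← hk]; omega
  have h2 := Finset.card_le_card h1
  rw [Finset.card_image_of_injective _ Fin.val_injective, Finset.card_union_of_disjoint,
    Nat.card_Ioo, Finset.card_range] at h2
  · refine le_trans ?_ h2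
    omega
  · rw [Finset.disjoint_left]
    intro a ha hb
    simp only [Finset.mem_Ioo, Finset.mem_range] at ha hb
    omega

/-- Both endpoints lie above `(n - 1) / 2`, hence within distance `(n - 1) / 2` of each other, so
the smaller one wins in `cyclic n`. The reversal lifts the larger endpoint from at least `n / 2` to
at least `n / 2 + 1`, and no other vertex gains. -/
theorem outDegree_update_lt {n : ℕ} (e : Edge n) (h : (n - 1) / 2 < (e.1.1 : ℕ)) {w : Fin n}
    (hw : w ≠ e.1.2) : outDegree (Function.update (cyclic n) e false) w <
      outDegree (Function.update (cyclic n) e false) e.1.2 := by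
  classical
  obtain ⟨⟨i, j⟩, hij⟩ := e
  simp only at h hw ⊢
  set y := Function.update (cyclic n) ⟨(i, j), hij⟩ false with hy
  have hye : y ⟨(i, j), hij⟩ = false := by simp [hy]
  have hyne : ∀ e, e ≠ ⟨(i, j), hij⟩ → y e = cyclic n e := fun e he => by
    simp [hy, Function.update_of_ne he]
  have hce : cyclic n ⟨(i, j), hij⟩ = true := by
    simp only [cyclic, decide_eq_true_eq]; have := j.2; omega
  have h1 : outDegree y w ≤ n / 2 := by
    refine le_trans (Finset.card_le_card fun u hu => ?_) (outDegree_cyclic_le w)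
    simp only [Finset.mem_filter, Finset.mem_univ, true_and] at hu ⊢
    rcases lt_trichotomy w u with hl | hl | hl
    · rw [arc_of_lt _ hl] at hu ⊢
      by_cases he : (⟨(w, u), hl⟩ : Edge n) = ⟨(i, j), hij⟩
      · rw [he, hye] at hu; simp at hu
      · rwa [← hyne _ he]
    · subst hl; exact absurd hu (not_arc_self _ _)
    · rw [arc_of_gt _ hl] at hu ⊢
      rwa [← hyne]
      intro he
      simp only [Subtype.mk.injEq, Prod.mk.injEq] at he
      exact hw he.2
  have h2 : outDegree (cyclic n) j + 1 ≤ outDegree y j := by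
    have hi : i ∉ Finset.univ.filter fun u => Arc (cyclic n) j u := by
      simp only [Finset.mem_filter, Finset.mem_univ, true_and]
      rw [arc_of_gt _ hij, hce]; simp
    rw [outDegree, ← Finset.card_insert_of_notMem hi]
    refine Finset.card_le_card (Finset.insert_subset ?_ fun u hu => ?_)
    · simp only [Finset.mem_filter, Finset.mem_univ, true_and]
      rw [arc_of_gt _ hij, hye]
    · simp only [Finset.mem_filter, Finset.mem_univ, true_and] at hu ⊢
      rcases lt_trichotomy j u with hl | hl | hl
      · rw [arc_of_lt _ hl] at hu ⊢
        rwa [hyne]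
        intro he
        simp only [Subtype.mk.injEq, Prod.mk.injEq] at he
        exact hij.ne he.1.symm
      · subst hl; exact absurd hu (not_arc_self _ _)
      · rw [arc_of_gt _ hl] at hu ⊢
        by_cases he : (⟨(u, j), hl⟩ : Edge n) = ⟨(i, j), hij⟩
        · rw [he, hye]
        · rwa [hyne _ he]
  have h3 := le_outDegree_cyclic (n := n) (w := j) (h.trans hij)
  omega

theorem le_of_computableWith_MOD {n T : ℕ} (hn : 2 ≤ n)
    (hT : QuantumQuery.ComputableWith (MOD n) T) : (n : ℝ) ≤ 1000 * T := by
  classical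
  have hT0 : 1 ≤ T := by
    rcases Nat.eq_zero_or_pos T with rfl | h
    · exact absurd hT (not_computableWith_zero_MOD hn)
    · exact h
  rcases le_or_gt n 1000 with h | h
  · exact_mod_cast (show n ≤ 1000 * T by omega)
  set k := (n - 1) / 2 with hk
  set m := n / 4 with hm
  -- All edges between two consecutive blocks of length `m` in the upper half: each possible answer,
  -- an element of the second block, is forced by only `m` of these `m * m` edges.
  let e : Fin m × Fin m → Edge n := fun p =>
    ⟨(⟨k + 1 + p.1, by omega⟩, ⟨k + 1 + m + p.2, by omega⟩), by rw [Fin.lt_def]; simp; omega⟩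
  have he : Function.Injective e := by
    rintro ⟨a, b⟩ ⟨a', b'⟩ hab
    simp only [e, Subtype.mk.injEq, Prod.mk.injEq, Fin.mk.injEq] at hab
    ext <;> simp <;> omega
  have : Nonempty (Fin n) := ⟨⟨0, by omega⟩⟩
  obtain ⟨r₀, hr₀⟩ := hT.exists_card_le (cyclic n)
    (fun i => Function.update (cyclic n) i false) (Finset.univ.image e) (fun i => i.1.2)
    (fun i _ j hj => Function.update_of_ne hj _ _) (by
      intro i hi s hs
      obtain ⟨p, -, rfl⟩ := Finset.mem_image.1 hi
      refine eq_of_MOD (fun w hw => outDegree_update_lt _ ?_ hw) hs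
      simp only [e, ← hk]; omega)
  have h1 : m * (m - 1) ≤ ((Finset.univ.image e).filter fun i => i.1.2 ≠ r₀).card := by
    have h2 : ((Finset.univ : Finset (Fin m)) ×ˢ
        (Finset.univ.filter fun b : Fin m => k + 1 + m + (b : ℕ) ≠ r₀)).image e ⊆
        (Finset.univ.image e).filter fun i => i.1.2 ≠ r₀ := by
      intro i hi
      obtain ⟨p, hp, rfl⟩ := Finset.mem_image.1 hi
      simp only [Finset.mem_product, Finset.mem_filter, Finset.mem_univ, true_and] at hp
      refine Finset.mem_filter.2 ⟨Finset.mem_image_of_mem _ (Finset.mem_univ _), ?_⟩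
      intro h3
      exact hp (by rw [← h3])
    refine le_trans ?_ (Finset.card_le_card h2)
    rw [Finset.card_image_of_injective _ he, Finset.card_product, Finset.card_univ,
      Fintype.card_fin]
    refine Nat.mul_le_mul_left _ ?_
    have h4 := Finset.card_filter_add_card_filter_not (s := (Finset.univ : Finset (Fin m)))
      (fun b : Fin m => k + 1 + m + (b : ℕ) ≠ r₀)
    have h5 : (Finset.univ.filter fun b : Fin m => ¬ (k + 1 + m + (b : ℕ) ≠ r₀)).card ≤ 1 := by
      rw [Finset.card_le_one]
      intro a ha b hb
      simp only [ne_eq, not_not, Finset.mem_filter, Finset.mem_univ, true_and] at ha hb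
      ext; omega
    simp only [Finset.card_univ, Fintype.card_fin] at h4
    omega
  have h2 : ((m * (m - 1) : ℕ) : ℝ) ≤ 336 * (T : ℝ) ^ 2 := le_trans (by exact_mod_cast h1) hr₀
  have h3 : m * (m - 1) ≤ 336 * T ^ 2 := by exact_mod_cast h2
  have h4 : n ≤ 5 * (m - 1) := by omega
  -- The product `25 * 336 = 8400` is far below `1000 ^ 2`; the constant `1000` also serves as the
  -- cutoff for small `n`.
  have h5 : n * n ≤ (1000 * T) * (1000 * T) := by
    calc n * n ≤ (5 * m) * (5 * (m - 1)) := Nat.mul_le_mul (by omega) h4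
      _ = 25 * (m * (m - 1)) := by ring
      _ ≤ 25 * (336 * T ^ 2) := Nat.mul_le_mul_left _ h3
      _ ≤ (1000 * T) * (1000 * T) := by nlinarith
  exact_mod_cast Nat.mul_self_le_mul_self_iff.1 h5

end Tournament

/-! ### Composition of query algorithms -/

namespace QuantumQuery

variable {ι R W : Type} [Fintype ι] [Fintype W]

/-- The family `V` of unitaries is of the form `V x = U_T O_x U_{T-1} O_x ⋯ O_x U_0`. -/
def Implements : ℕ → ((ι → Bool) → (StateSpace ι W ≃ₗᵢ[ℂ] StateSpace ι W)) → Prop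
  | 0, V => ∃ U, V = fun _ => U
  | T + 1, V => ∃ V' U, Implements T V' ∧ V = fun x => (V' x).trans ((oracle x).trans U)

theorem implements_const (U : StateSpace ι W ≃ₗᵢ[ℂ] StateSpace ι W) :
    Implements 0 (fun _ : ι → Bool => U) := ⟨U, rfl⟩

theorem implements_oracle : Implements (W := W) 1 (oracle (ι := ι)) :=
  ⟨_, .refl ℂ _, implements_const (.refl ℂ _), rfl⟩

theorem Implements.trans {T₁ T₂ : ℕ}
    {V₁ V₂ : (ι → Bool) → (StateSpace ι W ≃ₗᵢ[ℂ] StateSpace ι W)}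
    (h₁ : Implements T₁ V₁) (h₂ : Implements T₂ V₂) :
    Implements (T₁ + T₂) (fun x => (V₁ x).trans (V₂ x)) := by
  induction T₂ generalizing V₂ with
  | zero =>
    obtain ⟨U, rfl⟩ := h₂
    cases T₁ with
    | zero => obtain ⟨U', rfl⟩ := h₁; exact ⟨U'.trans U, rfl⟩
    | succ T =>
      obtain ⟨V', U', h, rfl⟩ := h₁
      exact ⟨V', U'.trans U, h, rfl⟩
  | succ T ih =>
    obtain ⟨V', U, h, rfl⟩ := h₂
    exact ⟨_, U, ih h, rfl⟩

theorem oracle_symm (x : ι → Bool) : (oracle (W := W) x).symm = oracle x := by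
  rw [oracle, LinearIsometryEquiv.piLpCongrLeft_symm]
  rfl

/-- Each oracle is its own inverse, so running backwards costs the same number of queries. This is
what makes uncomputation possible. -/
theorem Implements.symm {T : ℕ} {V : (ι → Bool) → (StateSpace ι W ≃ₗᵢ[ℂ] StateSpace ι W)}
    (h : Implements T V) : Implements T (fun x => (V x).symm) := by
  induction T generalizing V with
  | zero => obtain ⟨U, rfl⟩ := h; exact ⟨U.symm, rfl⟩
  | succ T ih =>
    obtain ⟨V', U, h, rfl⟩ := h
    have h1 := ((implements_const U.symm).trans implements_oracle).trans (ih h)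
    rw [show 0 + 1 + T = T + 1 by omega] at h1
    convert h1 using 2 with x
    ext ψ : 1
    change (V' x).symm ((oracle x).symm (U.symm ψ)) = (V' x).symm (oracle x (U.symm ψ))
    rw [oracle_symm]

theorem Implements.iterate {T : ℕ} {V : (ι → Bool) → (StateSpace ι W ≃ₗᵢ[ℂ] StateSpace ι W)}
    (h : Implements T V) (k : ℕ) : ∃ V', Implements (k * T) V' ∧ ∀ x ψ, V' x ψ = (V x)^[k] ψ := by
  induction k with
  | zero =>
    refine ⟨_, ?_, fun x ψ => (rfl : LinearIsometryEquiv.refl ℂ _ ψ = ψ)⟩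
    rw [Nat.zero_mul]
    exact implements_const _
  | succ k ih =>
    obtain ⟨V', h1, h2⟩ := ih
    refine ⟨_, (Nat.succ_mul k T).symm ▸ h1.trans h, fun x ψ => ?_⟩
    rw [Function.iterate_succ_apply', ← h2]
    rfl

theorem Algorithm.state_congr {A B : Algorithm ι R W} {T : ℕ} (h₀ : A.init = B.init)
    (h : ∀ t ≤ T, A.U t = B.U t) (x : ι → Bool) : A.state x T = B.state x T := by
  induction T with
  | zero => simp [Algorithm.state, h₀, h 0 le_rfl]
  | succ T ih => simp [Algorithm.state, h (T + 1) le_rfl, ih fun t ht => h t (by omega)]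

theorem Implements.exists_algorithm {T : ℕ}
    {V : (ι → Bool) → (StateSpace ι W ≃ₗᵢ[ℂ] StateSpace ι W)} (h : Implements T V)
    (φ : StateSpace ι W) (hφ : ‖φ‖ = 1) (out : BasisLabel ι W → R) :
    ∃ A : Algorithm ι R W, A.init = φ ∧ A.out = out ∧ ∀ x, A.state x T = V x φ := by
  induction T generalizing V with
  | zero =>
    obtain ⟨U, rfl⟩ := h
    exact ⟨⟨φ, hφ, fun _ => U, out⟩, rfl, rfl, fun x => rfl⟩
  | succ T ih =>
    obtain ⟨V', U, h, rfl⟩ := h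
    obtain ⟨A, rfl, rfl, hA⟩ := ih h
    refine ⟨⟨A.init, hφ, Function.update A.U (T + 1) U, A.out⟩, rfl, rfl, fun x => ?_⟩
    simp only [Algorithm.state, Function.update_self]
    have h1 := Algorithm.state_congr (A := ⟨A.init, hφ, Function.update A.U (T + 1) U, A.out⟩)
      (B := A) (T := T) rfl (fun t ht => Function.update_of_ne (by omega) _ _) x
    exact congrArg (fun ψ => U (oracle x ψ)) (h1.trans (hA x))

section Control

variable {W' C : Type} [Fintype W'] [Fintype C]

/-- The labels of the basis with workspace `W' ≃ W × C`, grouped by their control value in `C`. -/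
def controlEquiv (e : W' ≃ W × C) : BasisLabel ι W' ≃ (_ : C) × BasisLabel ι W where
  toFun l := ⟨(e l.2.2).2, l.1, l.2.1, (e l.2.2).1⟩
  invFun p := (p.2.1, p.2.2.1, e.symm (p.2.2.2, p.1))
  left_inv l := by simp
  right_inv p := by simp

/-- The unitary that applies `U c` if the control register holds `c`. -/
def control (e : W' ≃ W × C) (U : C → (StateSpace ι W ≃ₗᵢ[ℂ] StateSpace ι W)) :
    StateSpace ι W' ≃ₗᵢ[ℂ] StateSpace ι W' :=
  (LinearIsometryEquiv.piLpCongrLeft 2 ℂ ℂ (controlEquiv e)).trans <|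
    (LinearIsometryEquiv.piLpCurry ℂ 2 fun _ _ => ℂ).trans <|
    (LinearIsometryEquiv.piLpCongrRight 2 U).trans <|
    (LinearIsometryEquiv.piLpCurry ℂ 2 fun _ _ => ℂ).symm.trans
    (LinearIsometryEquiv.piLpCongrLeft 2 ℂ ℂ (controlEquiv e).symm)

theorem control_apply (e : W' ≃ W × C) (U : C → (StateSpace ι W ≃ₗᵢ[ℂ] StateSpace ι W))
    (ψ : StateSpace ι W') (i : Option ι) (b : Bool) (w : W') :
    control e U ψ (i, b, w) = U (e w).2
      (WithLp.toLp 2 fun l : BasisLabel ι W => ψ (l.1, l.2.1, e.symm (l.2.2, (e w).2)))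
      (i, b, (e w).1) := rfl

theorem control_oracle (e : W' ≃ W × C) (x : ι → Bool) :
    control e (fun _ => oracle x) = oracle x := by
  ext ψ ⟨i, b, w⟩
  rw [control_apply]
  cases i <;> simp [oracle_apply, queryFun]

theorem control_trans (e : W' ≃ W × C) (U V : C → (StateSpace ι W ≃ₗᵢ[ℂ] StateSpace ι W)) :
    control e (fun c => (U c).trans (V c)) = (control e U).trans (control e V) := by
  ext ψ ⟨i, b, w⟩
  simp [control_apply]

/-- All branches query at the same times, and a query does not look at the control register, so one
oracle call serves every branch at once. -/
theorem Implements.control {T : ℕ} (e : W' ≃ W × C)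
    {V : C → (ι → Bool) → (StateSpace ι W ≃ₗᵢ[ℂ] StateSpace ι W)}
    (h : ∀ c, Implements T (V c)) :
    Implements T (fun x => QuantumQuery.control e fun c => V c x) := by
  induction T generalizing V with
  | zero =>
    choose U hU using h
    obtain rfl := funext hU
    exact ⟨QuantumQuery.control e U, rfl⟩
  | succ T ih =>
    choose V' U h hV using h
    obtain rfl := funext hV
    refine ⟨_, QuantumQuery.control e U, ih h, ?_⟩
    funext x
    rw [control_trans, control_trans, control_oracle]

end Control

/-- The family of probability distributions on `R`, given by their expectations
`K s x : (R → ℝ) → ℝ`, is produced by `T`-query algorithms with a common workspace and initial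
state. -/
def Realizes {S R : Type} (T : ℕ) (K : S → (ι → Bool) → (R → ℝ) → ℝ) : Prop :=
  ∃ (W : Type) (_ : Fintype W) (φ : StateSpace ι W)
    (V : S → (ι → Bool) → (StateSpace ι W ≃ₗᵢ[ℂ] StateSpace ι W)) (out : S → BasisLabel ι W → R),
    ‖φ‖ = 1 ∧ (∀ s, Implements T (V s)) ∧
      ∀ s x g, K s x g = ∑ l, g (out s l) * ‖V s x φ l‖ ^ 2

theorem realizes_pure {S : Type} : Realizes (ι := ι) 0 (fun (s : S) _ (g : S → ℝ) => g s) := by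
  classical
  refine ⟨Unit, inferInstance, EuclideanSpace.single (none, false, ()) 1,
    fun _ _ => .refl ℂ _, fun s _ => s, by simp, fun _ => implements_const _, fun s x g => ?_⟩
  rw [← Finset.mul_sum, ← EuclideanSpace.norm_sq_eq]
  simp

/-- Deferred measurement: the final register of the first algorithm is kept unmeasured and controls
which second algorithm runs on a fresh register. The common workspace and initial state demanded by
`Realizes` let that fresh register be prepared before the first outcome is known. -/
theorem Realizes.bind {S R R' : Type} {T₁ T₂ : ℕ} {K₁ : S → (ι → Bool) → (R → ℝ) → ℝ}
    {K₂ : R → (ι → Bool) → (R' → ℝ) → ℝ} (h₁ : Realizes T₁ K₁) (h₂ : Realizes T₂ K₂) :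
    Realizes (T₁ + T₂) (fun s x g => K₁ s x fun r => K₂ r x g) := by
  obtain ⟨W₁, _, φ₁, V₁, out₁, hφ₁, hV₁, hK₁⟩ := h₁
  obtain ⟨W₂, _, φ₂, V₂, out₂, hφ₂, hV₂, hK₂⟩ := h₂
  let e₂ : W₁ × BasisLabel ι W₂ ≃ W₂ × BasisLabel ι W₁ :=
    { toFun := fun p => (p.2.2.2, p.2.1, p.2.2.1, p.1)
      invFun := fun p => (p.2.2.2, p.2.1, p.2.2.1, p.1)
      left_inv := fun _ => rfl
      right_inv := fun _ => rfl }
  -- Between the two runs, the query index and bit of the first are exchanged with the stored ones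
  -- of the second.
  let e : BasisLabel ι (W₁ × BasisLabel ι W₂) ≃ BasisLabel ι (W₁ × BasisLabel ι W₂) :=
    { toFun := fun l => (l.2.2.2.1, l.2.2.2.2.1, l.2.2.1, l.1, l.2.1, l.2.2.2.2.2)
      invFun := fun l => (l.2.2.2.1, l.2.2.2.2.1, l.2.2.1, l.1, l.2.1, l.2.2.2.2.2)
      left_inv := fun _ => rfl
      right_inv := fun _ => rfl }
  let σ : BasisLabel ι (W₁ × BasisLabel ι W₂) ≃ BasisLabel ι W₁ × BasisLabel ι W₂ :=
    { toFun := fun l => ((l.1, l.2.1, l.2.2.1), l.2.2.2)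
      invFun := fun l => (l.1.1, l.1.2.1, l.1.2.2, l.2)
      left_inv := fun _ => rfl
      right_inv := fun _ => rfl }
  refine ⟨W₁ × BasisLabel ι W₂, inferInstance,
    WithLp.toLp 2 fun l => φ₁ (l.1, l.2.1, l.2.2.1) * φ₂ l.2.2.2,
    fun s x => ((control (.refl _) fun _ => V₁ s x).trans
      (LinearIsometryEquiv.piLpCongrLeft 2 ℂ ℂ e)).trans
      (control e₂ fun c => V₂ (out₁ s c) x),
    fun s l => out₂ (out₁ s (l.2.2.2.1, l.2.2.2.2.1, l.2.2.1)) (l.1, l.2.1, l.2.2.2.2.2),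
    ?_, fun s => ?_, fun s x g => ?_⟩
  · have h : ‖(WithLp.toLp 2 fun l : BasisLabel ι (W₁ × BasisLabel ι W₂) =>
        φ₁ (l.1, l.2.1, l.2.2.1) * φ₂ l.2.2.2 : StateSpace ι _)‖ ^ 2 = 1 := by
      rw [EuclideanSpace.norm_sq_eq, Fintype.sum_equiv σ _
        (fun p => ‖φ₁ p.1‖ ^ 2 * ‖φ₂ p.2‖ ^ 2) (fun l => by simp [σ, mul_pow]),
        Fintype.sum_prod_type]
      dsimp only
      rw [← Fintype.sum_mul_sum (fun c => ‖φ₁ c‖ ^ 2) fun l => ‖φ₂ l‖ ^ 2,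
        ← EuclideanSpace.norm_sq_eq,
        ← EuclideanSpace.norm_sq_eq, hφ₁, hφ₂]
      norm_num
    exact (pow_eq_one_iff_of_nonneg (norm_nonneg _) two_ne_zero).1 h
  · exact ((Implements.control _ fun _ => hV₁ s).trans (implements_const _)).trans
      (Implements.control _ fun c => hV₂ (out₁ s c))
  · have h1 : ∀ (c : BasisLabel ι W₁) (l : BasisLabel ι W₂),
        (((control (.refl _) fun _ => V₁ s x).trans
          (LinearIsometryEquiv.piLpCongrLeft 2 ℂ ℂ e)).trans
          (control e₂ fun c => V₂ (out₁ s c) x))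
          (WithLp.toLp 2 fun l => φ₁ (l.1, l.2.1, l.2.2.1) * φ₂ l.2.2.2)
          (e.symm (σ.symm (c, l))) = V₁ s x φ₁ c * V₂ (out₁ s c) x φ₂ l := by
      rintro ⟨i, b, w⟩ ⟨i', b', w'⟩
      have h2 : ∀ z : ℂ, (WithLp.toLp 2 fun l : BasisLabel ι W₁ => φ₁ l * z : StateSpace ι W₁) =
          z • φ₁ := fun z => by
        ext l; simp [mul_comm]
      have h3 : ∀ z : ℂ, (WithLp.toLp 2 fun l : BasisLabel ι W₂ => z * φ₂ l : StateSpace ι W₂) =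
          z • φ₂ := fun z => by
        ext l; simp
      change V₂ (out₁ s (i, b, w)) x (WithLp.toLp 2 fun l : BasisLabel ι W₂ =>
        V₁ s x (WithLp.toLp 2 fun l' : BasisLabel ι W₁ => φ₁ l' * φ₂ l) (i, b, w))
        (i', b', w') = _
      simp only [h2, map_smul, PiLp.smul_apply, smul_eq_mul]
      simp only [mul_comm (φ₂ _), h3, map_smul, PiLp.smul_apply, smul_eq_mul]
    simp only [hK₁, hK₂, Finset.sum_mul]
    rw [← Fintype.sum_prod_type', ← Equiv.sum_comp (σ.symm.trans e.symm)]
    refine Finset.sum_congr rfl fun p _ => ?_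
    obtain ⟨c, l⟩ := p
    rw [Equiv.trans_apply, h1, norm_mul, mul_pow]
    simp only [e, σ, Equiv.coe_fn_symm_mk]
    ring

/-- The `r`-fold iteration of a kernel. -/
def iterKernel {S X : Type} (K : S → X → (S → ℝ) → ℝ) : ℕ → S → X → (S → ℝ) → ℝ
  | 0, s, _, g => g s
  | r + 1, s, x, g => K s x fun s' => iterKernel K r s' x g

theorem Realizes.iterKernel {S : Type} {T : ℕ} {K : S → (ι → Bool) → (S → ℝ) → ℝ}
    (h : Realizes T K) (r : ℕ) : Realizes (r * T) (iterKernel K r) := by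
  induction r with
  | zero => rw [Nat.zero_mul]; exact realizes_pure
  | succ r ih => rw [Nat.succ_mul, add_comm]; exact h.bind ih

open Classical in
theorem Realizes.computableWith {S R R' : Type} {T : ℕ} {K : S → (ι → Bool) → (R → ℝ) → ℝ}
    (h : Realizes T K) (s : S) (p : R → R') {f : (ι → Bool) → R' → Prop}
    (hf : ∀ x, 2 / 3 ≤ K s x fun r => if f x (p r) then 1 else 0) : ComputableWith f T := by
  obtain ⟨W, _, φ, V, out, hφ, hV, hK⟩ := h
  obtain ⟨A, -, hout, hA⟩ := (hV s).exists_algorithm φ hφ fun l => p (out s l)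
  refine ⟨W, inferInstance, A, fun x => (hf x).trans (le_of_eq ?_)⟩
  rw [hK, Algorithm.outputProb]
  refine Finset.sum_congr rfl fun l _ => ?_
  rw [hout, hA]
  simp

end QuantumQuery

/-! ### Basis states, and reading bits into a register -/

namespace QuantumQuery

section Basis

variable {ι W : Type} [Fintype ι] [Fintype W]

open Classical in
/-- The computational basis vector with label `l`. -/
def ket (l : BasisLabel ι W) : StateSpace ι W := EuclideanSpace.single l 1

open Classical in
theorem ket_apply (l l' : BasisLabel ι W) : ket l l' = if l' = l then 1 else 0 := by
  simp [ket]

theorem oracle_ket (x : ι → Bool) (l : BasisLabel ι W) :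
    oracle x (ket l) = ket (queryFun x l) := by
  ext l'
  classical
  rw [oracle_apply, ket_apply, ket_apply]
  exact if_congr (by rw [(queryFun_involutive x).eq_iff, eq_comm]) rfl rfl

/-- The unitary that permutes the computational basis by `σ`. -/
def permute (σ : Equiv.Perm (BasisLabel ι W)) : StateSpace ι W ≃ₗᵢ[ℂ] StateSpace ι W :=
  LinearIsometryEquiv.piLpCongrLeft 2 ℂ ℂ σ

theorem permute_ket (σ : Equiv.Perm (BasisLabel ι W)) (l : BasisLabel ι W) :
    permute σ (ket l) = ket (σ l) := by
  ext l'
  change ket l (σ.symm l') = _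
  classical
  rw [ket_apply, ket_apply]
  exact if_congr (Equiv.symm_apply_eq _) rfl rfl

open Classical in
/-- The unitary that changes the sign of the basis vectors whose labels satisfy `p`. -/
def signFlip (p : BasisLabel ι W → Prop) : StateSpace ι W ≃ₗᵢ[ℂ] StateSpace ι W :=
  LinearIsometryEquiv.piLpCongrRight 2 fun l =>
    if p l then LinearIsometryEquiv.neg ℂ else LinearIsometryEquiv.refl ℂ ℂ

open Classical in
theorem signFlip_ket (p : BasisLabel ι W → Prop) (l : BasisLabel ι W) :
    signFlip p (ket l) = (((if p l then -1 else 1 : ℝ)) : ℂ) • ket l := by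
  ext l'
  simp only [signFlip, LinearIsometryEquiv.piLpCongrRight_apply, PiLp.smul_apply, ket_apply]
  by_cases h : l' = l
  · subst h; by_cases hp : p l' <;> simp [hp]
  · by_cases hp : p l' <;> simp [hp, h]

end Basis

section Register

variable {ι α : Type} [Fintype ι] [Fintype α] {D : ℕ}

/-- The state `∑ u, a u |0⟩|0⟩|u, mem u⟩`. -/
def registerState (mem : α → Fin D → Bool) (a : α → ℝ) : StateSpace ι (α × (Fin D → Bool)) :=
  ∑ u, (a u : ℂ) • ket (none, false, u, mem u)

theorem registerState_apply_self (mem : α → Fin D → Bool) (a : α → ℝ) (u : α) :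
    (registerState mem a : StateSpace ι _) (none, false, u, mem u) = a u := by
  classical
  simp only [registerState, WithLp.ofLp_sum, Finset.sum_apply, PiLp.smul_apply, ket_apply]
  rw [Finset.sum_eq_single u]
  · simp
  · intro v _ hv
    simp [hv.symm]
  · simp

theorem registerState_apply_of_forall_ne (mem : α → Fin D → Bool) (a : α → ℝ)
    {l : BasisLabel ι (α × (Fin D → Bool))} (h : ∀ u, (none, false, u, mem u) ≠ l) :
    (registerState mem a : StateSpace ι _) l = 0 := by
  classical
  simp only [registerState, WithLp.ofLp_sum, Finset.sum_apply, PiLp.smul_apply, ket_apply]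
  exact Finset.sum_eq_zero fun u _ => by simp [(h u).symm]

/-- The labels in the support are distinct because `u` itself is part of them. Norms, inner products
and output expectations all reduce to this. -/
theorem sum_registerState {M : Type*} [AddCommMonoid M] (mem : α → Fin D → Bool) (a : α → ℝ)
    (G : BasisLabel ι (α × (Fin D → Bool)) → ℂ → M) (hG : ∀ l, G l 0 = 0) :
    ∑ l, G l (registerState mem a l) = ∑ u, G (none, false, u, mem u) (a u) := by
  refine (Fintype.sum_of_injective (fun u => (none, false, u, mem u)) (fun u v h => ?_) _ _
    (fun l hl => ?_) fun u => ?_).symm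
  · simp only [Prod.mk.injEq, true_and] at h
    exact h.1
  · rw [registerState_apply_of_forall_ne mem a fun u hu => hl ⟨u, hu⟩, hG]
  · rw [registerState_apply_self]

theorem norm_registerState_sq (mem : α → Fin D → Bool) (a : α → ℝ) :
    ‖(registerState mem a : StateSpace ι _)‖ ^ 2 = ∑ u, a u ^ 2 := by
  rw [EuclideanSpace.norm_sq_eq, sum_registerState mem a (fun _ z => ‖z‖ ^ 2) (by simp)]
  simp

theorem inner_registerState (mem : α → Fin D → Bool) (a b : α → ℝ) :
    inner ℂ (registerState mem a : StateSpace ι _) (registerState mem b) =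
      ((∑ u, a u * b u : ℝ) : ℂ) := by
  rw [PiLp.inner_apply, sum_registerState mem b
    (fun l z => inner ℂ ((registerState mem a : StateSpace ι _) l) z) (by simp)]
  simp only [registerState_apply_self]
  push_cast
  refine Finset.sum_congr rfl fun u _ => ?_
  simp [mul_comm]

theorem map_registerState (V : StateSpace ι (α × (Fin D → Bool)) ≃ₗᵢ[ℂ] StateSpace ι _)
    {mem mem' : α → Fin D → Bool} (c a : α → ℝ)
    (h : ∀ u, V (ket (none, false, u, mem u)) = (c u : ℂ) • ket (none, false, u, mem' u)) :
    V (registerState mem a) = registerState mem' fun u => c u * a u := by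
  simp only [registerState, map_sum, map_smul, h, smul_smul]
  refine Finset.sum_congr rfl fun u _ => ?_
  push_cast
  rw [mul_comm]

theorem reflection_registerState (mem : α → Fin D → Bool) {a : α → ℝ} (ha : ∑ u, a u ^ 2 = 1)
    (b : α → ℝ) :
    (Submodule.span ℂ {(registerState mem a : StateSpace ι _)}).reflection (registerState mem b) =
      registerState mem fun u => 2 * (∑ v, a v * b v) * a u - b u := by
  rw [Submodule.reflection_singleton_apply, inner_registerState]
  have h : ((‖(registerState mem a : StateSpace ι _)‖ : ℂ)) ^ 2 = 1 := by
    rw [← Complex.ofReal_pow, norm_registerState_sq, ha, Complex.ofReal_one]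
  have h' : (RCLike.ofReal ‖(registerState mem a : StateSpace ι _)‖ : ℂ) ^ 2 = 1 := h
  rw [h', div_one]
  simp only [registerState, Finset.smul_sum, ← Finset.sum_sub_distrib, smul_smul]
  refine Finset.sum_congr rfl fun u _ => ?_
  rw [two_smul, ← add_smul, ← sub_smul]
  push_cast
  congr 1
  ring

variable (F : α → Fin D → Option ι)

/-- The bits of `x` at the positions `F u`; the bit at the position `none` is `false`. -/
def row (x : ι → Bool) (u : α) (s : Fin D) : Bool := (F u s).elim false x

theorem exists_implements_read_prefix (t : ℕ) (ht : t ≤ D) :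
    ∃ V, Implements t V ∧ ∀ (x : ι → Bool) (u : α), V x (ket (none, false, u, fun _ => false)) =
      ket (none, false, u, fun s => if s.val < t then row F x u s else false) := by
  classical
  induction t with
  | zero => exact ⟨_, implements_const (.refl ℂ _), fun x u => by simp⟩
  | succ t ih =>
    obtain ⟨V, hV, h⟩ := ih (by omega)
    let s : Fin D := ⟨t, ht⟩
    -- `P` moves the query index from `none` to `F u s` and back; `P'` exchanges the query bit with
    -- the still blank cell `s`, which also resets that bit for the next read.
    let P : Equiv.Perm (BasisLabel ι (α × (Fin D → Bool))) := Function.Involutive.toPerm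
      (fun l => (Equiv.swap none (F l.2.2.1 s) l.1, l.2)) (fun l => by simp)
    let P' : Equiv.Perm (BasisLabel ι (α × (Fin D → Bool))) := Function.Involutive.toPerm
      (fun l => (l.1, l.2.2.2 s, l.2.2.1, Function.update l.2.2.2 s l.2.1))
      (fun l => by simp)
    have hP : ∀ l, P l = (Equiv.swap none (F l.2.2.1 s) l.1, l.2) := fun _ => rfl
    have hP' : ∀ l, P' l = (l.1, l.2.2.2 s, l.2.2.1, Function.update l.2.2.2 s l.2.1) :=
      fun _ => rfl
    refine ⟨_, ((hV.trans (implements_const (permute P))).trans implements_oracle).trans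
      (implements_const ((permute P).trans (permute P'))), fun x u => ?_⟩
    change permute P' (permute P (oracle x (permute P (V x _)))) = _
    rw [h, permute_ket, oracle_ket, permute_ket, permute_ket]
    congr 1
    set m : Fin D → Bool := fun s => if s.val < t then row F x u s else false with hm
    have h1 : queryFun x (P (none, false, u, m)) = (F u s, row F x u s, u, m) := by
      simp only [hP, Equiv.swap_apply_left, row]
      cases F u s <;> simp [queryFun]
    have h2 : P (F u s, row F x u s, u, m) = (none, row F x u s, u, m) := by
      simp [hP]
    have h3 : m s = false := by simp [hm, s]
    rw [h1, h2]
    simp only [hP', h3, Prod.mk.injEq, true_and]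
    funext s'
    by_cases hs : s' = s
    · subst hs; simp [s]
    · have : s'.val ≠ t := fun h => hs (Fin.ext h)
      rw [Function.update_of_ne hs]
      simp only [hm]
      have : s'.val < t ↔ s'.val < t + 1 := by omega
      simp [this]

theorem exists_implements_read :
    ∃ V, Implements D V ∧ ∀ (x : ι → Bool) (u : α), V x (ket (none, false, u, fun _ => false)) =
      ket (none, false, u, row F x u) := by
  obtain ⟨V, hV, h⟩ := exists_implements_read_prefix F D le_rfl
  exact ⟨V, hV, fun x u => by simpa using h x u⟩

end Register

end QuantumQuery

/-! ### Grover search -/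

namespace QuantumQuery

section Search

variable {ι α : Type} [Fintype ι] [Fintype α] {D : ℕ} (F : α → Fin D → Option ι)
  (val : α → (Fin D → Bool) → ℕ)

theorem exists_inversion_about_average [Nonempty α] (mem : α → Fin D → Bool) :
    ∃ U : StateSpace ι (α × (Fin D → Bool)) ≃ₗᵢ[ℂ] StateSpace ι _, ∀ a : α → ℝ,
      U (registerState mem a) =
        registerState mem fun u => 2 * ((∑ v, a v) / Fintype.card α) - a u := by
  have hN : (0 : ℝ) < Fintype.card α := by exact_mod_cast Fintype.card_pos
  set c : ℝ := √(Fintype.card α) with hc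
  have hc0 : 0 < c := Real.sqrt_pos.2 hN
  have hc2 : c * c = Fintype.card α := Real.mul_self_sqrt hN.le
  have hs : ∑ _u : α, (1 / c) ^ 2 = 1 := by
    rw [Finset.sum_const, nsmul_eq_mul, Finset.card_univ, ← hc2]
    field_simp
  refine ⟨_, fun a => (reflection_registerState mem hs a).trans ?_⟩
  congr 1
  funext u
  rw [← Finset.mul_sum, ← hc2]
  field_simp

/-- One Grover iteration for the marked elements `u` with `d < val u (row F x u)`: it acts on the
amplitudes by a sign change at the marked elements and an inversion about the average. -/
theorem exists_implements_grover_iteration [Nonempty α] (d : ℕ) :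
    ∃ V : (ι → Bool) → (StateSpace ι (α × (Fin D → Bool)) ≃ₗᵢ[ℂ] StateSpace ι _),
      Implements (2 * D) V ∧ ∀ (x : ι → Bool) (a : α → ℝ),
        V x (registerState (fun _ _ => false) a) = registerState (fun _ _ => false) fun u =>
          2 * ((∑ v, (if d < val v (row F x v) then -1 else 1) * a v) / Fintype.card α) -
            (if d < val u (row F x u) then -1 else 1) * a u := by
  obtain ⟨V, hV, h⟩ := exists_implements_read (α := α) F
  obtain ⟨U, hU⟩ := exists_inversion_about_average (ι := ι) fun (_ : α) (_ : Fin D) => false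
  obtain ⟨P, hP⟩ : ∃ P : StateSpace ι (α × (Fin D → Bool)) ≃ₗᵢ[ℂ] StateSpace ι _,
      P = signFlip fun l => d < val l.2.2.1 l.2.2.2 := ⟨_, rfl⟩
  -- Read, mark by a sign, unread, invert. Without the unreading, the memory would stay entangled
  -- with `u` and the averaging would not interfere.
  have h1 := ((hV.trans (implements_const P)).trans hV.symm).trans (implements_const U)
  rw [show D + 0 + D + 0 = 2 * D by omega] at h1
  refine ⟨_, h1, fun x a => ?_⟩
  simp only [LinearIsometryEquiv.trans_apply]
  rw [map_registerState (V x) (mem' := row F x) (fun _ => 1) a (fun u => by rw [h]; simp),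
    map_registerState P (fun u => if d < val u (row F x u) then -1 else 1) _
      (mem' := row F x) (fun u => by
        rw [hP, signFlip_ket]; by_cases hd : d < val u (row F x u) <;> simp [hd]),
    map_registerState (V x).symm (fun _ => 1) _ (mem' := fun _ _ => false) (fun u => by
      rw [LinearIsometryEquiv.symm_apply_eq]; simp [h]), hU]
  simp only [one_mul]

/-- The amplitudes after `k` Grover iterations, if a fraction `sin θ ^ 2` of all elements is
marked. -/
theorem exists_grover_amplitude (p : α → Prop) [DecidablePred p] {θ κ : ℝ}
    (hN : 0 < Fintype.card α)
    (hθ : Real.sin θ ^ 2 * Fintype.card α = (Finset.univ.filter p).card) (G : (α → ℝ) → α → ℝ)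
    (hG : ∀ a u, G a u =
      2 * ((∑ v, (if p v then -1 else 1) * a v) / Fintype.card α) - (if p u then -1 else 1) * a u)
    (k : ℕ) : ∃ A B : ℝ, (G^[k] fun _ => κ) = (fun u => if p u then A else B) ∧
      Real.sin θ * A = κ * Real.sin ((2 * k + 1) * θ) ∧
      Real.cos θ * B = κ * Real.cos ((2 * k + 1) * θ) := by
  induction k with
  | zero => exact ⟨κ, κ, by simp, by simp [mul_comm], by simp [mul_comm]⟩
  | succ k ih =>
    obtain ⟨A, B, h1, hA, hB⟩ := ih
    have hN' : (0 : ℝ) < Fintype.card α := by exact_mod_cast hN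
    have h2 := Finset.card_filter_add_card_filter_not (s := (Finset.univ : Finset α)) p
    have h3 : ((Finset.univ.filter fun u => ¬ p u).card : ℝ) =
        Fintype.card α * Real.cos θ ^ 2 := by
      have h4 : ((Finset.univ.filter p).card : ℝ) + (Finset.univ.filter fun u => ¬ p u).card =
          Fintype.card α := by exact_mod_cast h2
      rw [Real.cos_sq']
      linarith
    have h5 : (∑ v, (if p v then -1 else 1) * (if p v then A else B)) / Fintype.card α =
        Real.cos θ ^ 2 * B - Real.sin θ ^ 2 * A := by
      have : ∀ v, (if p v then (-1 : ℝ) else 1) * (if p v then A else B) =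
          if p v then -A else B := fun v => by split_ifs <;> simp
      simp only [this, Finset.sum_ite, Finset.sum_const, nsmul_eq_mul]
      rw [h3, ← hθ]
      field_simp
      ring
    -- In the coordinates `sin θ * A`, `cos θ * B` the iteration is the rotation by `2 * θ`. Keeping
    -- the factors instead of dividing covers the cases where no element or every element is marked.
    refine ⟨2 * (Real.cos θ ^ 2 * B - Real.sin θ ^ 2 * A) + A,
      2 * (Real.cos θ ^ 2 * B - Real.sin θ ^ 2 * A) - B, ?_, ?_, ?_⟩
    · rw [Function.iterate_succ_apply', h1]
      funext u
      rw [hG, h5]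
      split_ifs <;> ring
    · have e : (2 * ((k + 1 : ℕ) : ℝ) + 1) * θ = (2 * k + 1) * θ + 2 * θ := by push_cast; ring
      rw [e, Real.sin_add, Real.sin_two_mul, Real.cos_two_mul]
      have : Real.sin θ * (2 * (Real.cos θ ^ 2 * B - Real.sin θ ^ 2 * A) + A) =
          2 * Real.sin θ * Real.cos θ * (Real.cos θ * B) +
            (1 - 2 * Real.sin θ ^ 2) * (Real.sin θ * A) := by ring
      rw [this, hA, hB, Real.sin_sq]
      ring
    · have e : (2 * ((k + 1 : ℕ) : ℝ) + 1) * θ = (2 * k + 1) * θ + 2 * θ := by push_cast; ring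
      rw [e, Real.cos_add, Real.sin_two_mul, Real.cos_two_mul]
      have : Real.cos θ * (2 * (Real.cos θ ^ 2 * B - Real.sin θ ^ 2 * A) - B) =
          (2 * Real.cos θ ^ 2 - 1) * (Real.cos θ * B) -
            2 * Real.sin θ * Real.cos θ * (Real.sin θ * A) := by ring
      rw [this, hA, hB]
      ring

/-- Jordan's inequality turns `s * sin θ ≤ 1` into `s * θ ≤ π / 2`, so there is no overshoot, and
applied again at `s * θ` it gives `A ≥ (2 / π) * s / √N`. Finally `4 / π ^ 2 ≥ 2 / 5`. -/
theorem le_grover_amplitude_sq {s N : ℝ} (hN : 0 < N) (hs : 1 ≤ s) {θ A : ℝ} (hθ0 : 0 < θ)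
    (hθ1 : θ ≤ Real.pi / 2) (hθ : s * Real.sin θ ≤ 1)
    (hA : Real.sin θ * A = 1 / √N * Real.sin (s * θ)) : 2 / 5 * (s ^ 2 / N) ≤ A ^ 2 := by
  have hpi := Real.pi_pos
  have h1 : 2 / Real.pi * θ ≤ Real.sin θ := Real.mul_le_sin hθ0.le hθ1
  have h2 : Real.sin θ ≤ θ := Real.sin_le hθ0.le
  have hsin : 0 < Real.sin θ := Real.sin_pos_of_pos_of_lt_pi hθ0 (by linarith)
  have h3 : s * θ ≤ Real.pi / 2 := by
    have h4 : s * (2 / Real.pi * θ) ≤ 1 := (mul_le_mul_of_nonneg_left h1 (by linarith)).trans hθ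
    have h5 : s * θ = Real.pi / 2 * (s * (2 / Real.pi * θ)) := by field_simp
    rw [h5]
    nlinarith
  have h4 : 2 / Real.pi * (s * θ) ≤ Real.sin (s * θ) := Real.mul_le_sin (by positivity) h3
  have h5 : 1 / √N * (2 / Real.pi * s) ≤ A := by
    have h6 : Real.sin θ * (1 / √N * (2 / Real.pi * s)) ≤ Real.sin θ * A := by
      rw [hA]
      calc Real.sin θ * (1 / √N * (2 / Real.pi * s))
          ≤ θ * (1 / √N * (2 / Real.pi * s)) :=
            mul_le_mul_of_nonneg_right h2 (by positivity)
        _ = 1 / √N * (2 / Real.pi * (s * θ)) := by ring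
        _ ≤ _ := mul_le_mul_of_nonneg_left h4 (by positivity)
    exact le_of_mul_le_mul_left h6 hsin
  have h6 := pow_le_pow_left₀ (by positivity) h5 2
  refine le_trans ?_ h6
  have h7 : (1 / √N * (2 / Real.pi * s)) ^ 2 = 4 / Real.pi ^ 2 * (s ^ 2 / N) := by
    rw [mul_pow, div_pow, Real.sq_sqrt hN.le]
    field_simp
    norm_num
  rw [h7]
  refine mul_le_mul_of_nonneg_right ?_ (by positivity)
  rw [div_le_div_iff₀ (by norm_num) (by positivity)]
  nlinarith [Real.pi_lt_d2]

/-- The elements of value greater than `d`. -/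
def above (f : α → ℕ) (d : ℕ) : Finset α := Finset.univ.filter fun u => d < f u

theorem mem_above {f : α → ℕ} {d : ℕ} {u : α} : u ∈ above f d ↔ d < f u := by simp [above]

/-- The best element and value seen so far, after the element `u` is inspected. -/
def improve (f : α → ℕ) (s : α × ℕ) (u : α) : α × ℕ := if s.2 < f u then (u, f u) else s

/-- Grover search with `k` iterations for an element of value greater than `s.2`. -/
theorem exists_realizes_search [Nonempty α] (k : ℕ) :
    ∃ w : (ι → Bool) → ℕ → α → ℝ, (∀ x d u, 0 ≤ w x d u) ∧ (∀ x d, ∑ u, w x d u = 1) ∧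
      (∀ x d u, u ∈ above (fun v => val v (row F x v)) d →
        (2 * k + 1) ^ 2 * (above (fun v => val v (row F x v)) d).card ≤ Fintype.card α →
        2 / 5 * (((2 * k + 1 : ℕ) : ℝ) ^ 2 / Fintype.card α) ≤ w x d u) ∧
      Realizes ((2 * k + 1) * D) fun (s : α × ℕ) x (g : α × ℕ → ℝ) =>
        ∑ u, g (improve (fun v => val v (row F x v)) s u) * w x s.2 u := by
  classical
  have hN : (0 : ℝ) < Fintype.card α := by exact_mod_cast Fintype.card_pos
  obtain ⟨V, hV, hVr⟩ := exists_implements_read (α := α) F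
  choose G hG hGr using fun d => exists_implements_grover_iteration F val d
  choose G' hG' hGr' using fun d => (hG d).iterate k
  let g : (ι → Bool) → ℕ → (α → ℝ) → α → ℝ := fun x d a u =>
    2 * ((∑ v, (if d < val v (row F x v) then -1 else 1) * a v) / Fintype.card α) -
      (if d < val u (row F x u) then -1 else 1) * a u
  let κ : ℝ := 1 / √(Fintype.card α)
  have hκ : ∑ _u : α, κ ^ 2 = 1 := by
    simp only [κ]
    rw [Finset.sum_const, nsmul_eq_mul, Finset.card_univ, div_pow, Real.sq_sqrt hN.le]
    field_simp
  have hstate : ∀ d x, ((G' d x).trans (V x)) (registerState (fun _ _ => false) fun _ => κ) =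
      registerState (row F x) ((g x d)^[k] fun _ => κ) := by
    intro d x
    have h1 : ∀ k a, (G d x)^[k] (registerState (fun _ _ => false) a) =
        registerState (fun _ _ => false) ((g x d)^[k] a) := by
      intro k
      induction k with
      | zero => intro a; rfl
      | succ k ih => intro a; rw [Function.iterate_succ_apply, Function.iterate_succ_apply,
          hGr, ih]
    rw [LinearIsometryEquiv.trans_apply, hGr', h1,
      map_registerState (V x) (mem' := row F x) (fun _ => 1) _ (fun u => by rw [hVr]; simp)]
    simp
  refine ⟨fun x d u => ((g x d)^[k] fun _ => κ) u ^ 2, fun _ _ _ => sq_nonneg _, fun x d => ?_,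
    fun x d u hu hm => ?_, α × (Fin D → Bool), inferInstance,
    registerState (fun _ _ => false) fun _ => κ, fun s x => (G' s.2 x).trans (V x),
    fun s l => if s.2 < val l.2.2.1 l.2.2.2 then (l.2.2.1, val l.2.2.1 l.2.2.2) else s,
    ?_, fun s => ?_, fun s x h => ?_⟩
  · rw [← norm_registerState_sq (ι := ι) (row F x), ← hstate, LinearIsometryEquiv.norm_map,
      norm_registerState_sq, hκ]
  · set m := (above (fun v => val v (row F x v)) d).card with hmdef
    have hm0 : 0 < m := Finset.card_pos.2 ⟨u, hu⟩
    have hmN : (m : ℝ) / Fintype.card α ≤ 1 := by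
      rw [div_le_one hN]
      exact_mod_cast Finset.card_le_univ _
    have hmpos : 0 < (m : ℝ) / Fintype.card α := by positivity
    set σ := √((m : ℝ) / Fintype.card α) with hσ
    have hσ0 : 0 < σ := Real.sqrt_pos.2 hmpos
    have hσ1 : σ ≤ 1 := Real.sqrt_le_one.2 hmN
    have hsin : Real.sin (Real.arcsin σ) = σ := Real.sin_arcsin (by linarith) hσ1
    obtain ⟨A, B, h1, hA, -⟩ := exists_grover_amplitude (κ := κ) (θ := Real.arcsin σ)
      (fun u => d < val u (row F x u)) Fintype.card_pos (by
        rw [hsin, hσ, Real.sq_sqrt hmpos.le]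
        field_simp
        rw [hmdef, above]) (g x d) (fun _ _ => rfl) k
    simp only [h1, if_pos (mem_above.1 hu)]
    refine le_grover_amplitude_sq hN (by simp) (Real.arcsin_pos.2 hσ0)
      (Real.arcsin_le_pi_div_two σ) ?_ (by push_cast; exact hA)
    rw [hsin]
    refine abs_le_of_sq_le_sq' ?_ zero_le_one |>.2
    rw [mul_pow, hσ, Real.sq_sqrt hmpos.le, one_pow, ← mul_div_assoc, div_le_one hN]
    exact_mod_cast hm
  · have := norm_registerState_sq (ι := ι) (fun (_ : α) (_ : Fin D) => false) fun _ => κ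
    rw [hκ] at this
    exact (pow_eq_one_iff_of_nonneg (norm_nonneg _) two_ne_zero).1 this
  -- The `k` iterations cost `2 * D` each; the extra `D` queries read the row of the element found,
  -- so that its value is known at the output.
  · have h1 := (hG' s.2).trans hV
    rwa [show k * (2 * D) + D = (2 * k + 1) * D by ring] at h1
  · rw [hstate, sum_registerState _ _ (fun l z => h (if s.2 < val l.2.2.1 l.2.2.2 then
      (l.2.2.1, val l.2.2.1 l.2.2.2) else s) * ‖z‖ ^ 2) (by simp)]
    refine Finset.sum_congr rfl fun u _ => ?_
    simp [improve]

end Search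

end QuantumQuery

/-! ### Maximum finding -/

namespace QuantumQuery

section Maximum

variable {α : Type} [Fintype α]

/-- The value `s.2` is at most that of the element `s.1`, and at most a fraction `9⁻ʲ` of all
elements have a greater value. -/
def IsGood (f : α → ℕ) (j : ℕ) (s : α × ℕ) : Prop :=
  s.2 ≤ f s.1 ∧ 9 ^ j * (above f s.2).card ≤ Fintype.card α

theorem above_anti (f : α → ℕ) {d d' : ℕ} (h : d ≤ d') : above f d' ⊆ above f d := fun _ hu =>
  mem_above.2 (h.trans_lt (mem_above.1 hu))

theorem IsGood.improve {f : α → ℕ} {j : ℕ} {s : α × ℕ} (h : IsGood f j s) (u : α) :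
    IsGood f j (improve f s u) := by
  unfold QuantumQuery.improve
  split_ifs with hu
  · exact ⟨le_rfl, le_trans (Nat.mul_le_mul_left _ (Finset.card_le_card (above_anti f hu.le))) h.2⟩
  · exact h

/-- If the filtered set `B` were small, some element above `d` would lie outside it. For such an
element of largest value, everything above it lies in `B`, so few elements are above it and it
belongs to `B` after all. -/
theorem lt_mul_card_above_filter (f : α → ℕ) {d M N : ℕ} (h : N < M * (above f d).card) :
    N < M * ((above f d).filter fun u => M * (above f (f u)).card ≤ N).card := by
  classical
  by_contra! hle
  set B := (above f d).filter fun u => M * (above f (f u)).card ≤ N with hB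
  have hne : (above f d \ B).Nonempty := by
    rw [Finset.sdiff_nonempty]
    intro hsub
    exact absurd (Nat.mul_le_mul_left M (Finset.card_le_card hsub)) (by omega)
  obtain ⟨u, hu, hmax⟩ := Finset.exists_max_image _ f hne
  obtain ⟨hu1, hu2⟩ := Finset.mem_sdiff.1 hu
  have hsub : above f (f u) ⊆ B := by
    intro v hv
    have hv' := mem_above.1 hv
    by_contra hvB
    exact absurd (hmax v (Finset.mem_sdiff.2
      ⟨mem_above.2 ((mem_above.1 hu1).trans hv'), hvB⟩)) (by omega)
  exact hu2 (Finset.mem_filter.2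
    ⟨hu1, (Nat.mul_le_mul_left M (Finset.card_le_card hsub)).trans hle⟩)

open Classical in
-- More than `N / 9 ^ (j + 1)` elements lead to the next level, each with weight at least `2 / 5 * 9
-- ^ j / N`; the product is `2 / 45`.
theorem le_sum_isGood_improve {f : α → ℕ} {j : ℕ} {s : α × ℕ} {w : α → ℝ} (hw : ∀ u, 0 ≤ w u)
    (hs : IsGood f j s) (hs' : ¬ IsGood f (j + 1) s)
    (hlow : ∀ u ∈ above f s.2, 2 / 5 * ((9 : ℝ) ^ j / Fintype.card α) ≤ w u) :
    2 / 45 ≤ ∑ u, if IsGood f (j + 1) (improve f s u) then w u else 0 := by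
  have : Nonempty α := ⟨s.1⟩
  have hN : (0 : ℝ) < Fintype.card α := by exact_mod_cast Fintype.card_pos
  set B := (above f s.2).filter fun u => 9 ^ (j + 1) * (above f (f u)).card ≤ Fintype.card α
    with hB
  have h1 : Fintype.card α < 9 ^ (j + 1) * B.card :=
    lt_mul_card_above_filter f (by by_contra! h; exact hs' ⟨hs.1, h⟩)
  have h2 : ∑ u ∈ B, 2 / 5 * ((9 : ℝ) ^ j / Fintype.card α) ≤
      ∑ u, if IsGood f (j + 1) (improve f s u) then w u else 0 := by
    refine (Finset.sum_le_sum fun u hu => ?_).trans (Finset.sum_le_univ_sum_of_nonneg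
      fun u => ?_)
    · obtain ⟨hu1, hu2⟩ := Finset.mem_filter.1 hu
      have h3 : IsGood f (j + 1) (improve f s u) := by
        rw [improve, if_pos (mem_above.1 hu1)]
        exact ⟨le_rfl, hu2⟩
      rw [if_pos h3]
      exact hlow u hu1
    · split_ifs
      · exact hw u
      · exact le_rfl
  refine le_trans ?_ h2
  rw [Finset.sum_const, nsmul_eq_mul]
  have h3 : (Fintype.card α : ℝ) ≤ 9 ^ (j + 1) * B.card := by exact_mod_cast h1.le
  have h4 : (B.card : ℝ) * (2 / 5 * ((9 : ℝ) ^ j / Fintype.card α)) =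
      2 / 45 * ((9 ^ (j + 1) * B.card) / Fintype.card α) := by
    rw [pow_succ]; field_simp; ring
  rw [h4]
  have h5 := (one_le_div hN).2 h3
  linarith

/-- The transition of a maximum search that inspects `u` with probability `w x d u`, where `d` is
the best value seen so far. -/
def stepKernel {X : Type} (f : X → α → ℕ) (w : X → ℕ → α → ℝ) (s : α × ℕ) (x : X)
    (g : α × ℕ → ℝ) : ℝ :=
  ∑ u, g (improve (f x) s u) * w x s.2 u

theorem stepKernel_nonneg {X : Type} {f : X → α → ℕ} {w : X → ℕ → α → ℝ} {x : X}
    (hw : ∀ d u, 0 ≤ w x d u) {g : α × ℕ → ℝ} (hg : ∀ s, 0 ≤ g s) (s : α × ℕ) :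
    0 ≤ stepKernel f w s x g :=
  Finset.sum_nonneg fun _ _ => mul_nonneg (hg _) (hw _ _)

theorem iterKernel_stepKernel_nonneg {X : Type} {f : X → α → ℕ} {w : X → ℕ → α → ℝ} {x : X}
    (hw : ∀ d u, 0 ≤ w x d u) {g : α × ℕ → ℝ} (hg : ∀ s, 0 ≤ g s) (r : ℕ) (s : α × ℕ) :
    0 ≤ iterKernel (stepKernel f w) r s x g := by
  induction r generalizing s with
  | zero => exact hg s
  | succ r ih => exact stepKernel_nonneg hw ih s

/-- The weights `w` form a probability distribution for each threshold `d`, and, if at most a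
fraction `9⁻ʲ` of all elements are above `d`, then each of these has the weight of `≈ 3ʲ` Grover
iterations. -/
structure IsSearch (f : α → ℕ) (j : ℕ) (w : ℕ → α → ℝ) : Prop where
  nonneg : ∀ d u, 0 ≤ w d u
  sum_eq_one : ∀ d, ∑ u, w d u = 1
  le_weight : ∀ d, ∀ u ∈ above f d, 9 ^ j * (above f d).card ≤ Fintype.card α →
    2 / 5 * ((9 : ℝ) ^ j / Fintype.card α) ≤ w d u

theorem le_stepKernel_of_isGood_succ {X : Type} {f : X → α → ℕ} {w : X → ℕ → α → ℝ} {x : X}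
    {j : ℕ} (hw : IsSearch (f x) j (w x)) {g : α × ℕ → ℝ} {c : ℝ}
    (hc : ∀ s, IsGood (f x) (j + 1) s → c ≤ g s) {s : α × ℕ} (hs : IsGood (f x) (j + 1) s) :
    c ≤ stepKernel f w s x g := by
  calc c = ∑ u, c * w x s.2 u := by rw [← Finset.mul_sum, hw.sum_eq_one, mul_one]
    _ ≤ _ := Finset.sum_le_sum fun u _ =>
      mul_le_mul_of_nonneg_right (hc _ (hs.improve u)) (hw.nonneg _ _)

theorem le_stepKernel {X : Type} {f : X → α → ℕ} {w : X → ℕ → α → ℝ} {x : X} {j : ℕ}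
    (hw : IsSearch (f x) j (w x)) {g : α × ℕ → ℝ} {b c : ℝ} (hbc : b ≤ c)
    (hb : ∀ s, IsGood (f x) j s → b ≤ g s) (hc : ∀ s, IsGood (f x) (j + 1) s → c ≤ g s)
    {s : α × ℕ} (hs : IsGood (f x) j s) :
    b + (c - b) * (2 / 45) ≤ stepKernel f w s x g := by
  classical
  by_cases hs' : IsGood (f x) (j + 1) s
  · have h1 := le_stepKernel_of_isGood_succ hw hc hs'
    linarith
  · have h1 := le_sum_isGood_improve (hw.nonneg s.2) hs hs'
      fun u hu => hw.le_weight s.2 u hu hs.2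
    calc b + (c - b) * (2 / 45)
        ≤ b + (c - b) * ∑ u, (if IsGood (f x) (j + 1) (improve (f x) s u) then w x s.2 u
            else 0) := by
          have := mul_le_mul_of_nonneg_left h1 (sub_nonneg.2 hbc)
          linarith
      _ = ∑ u, (b + (c - b) * if IsGood (f x) (j + 1) (improve (f x) s u) then 1 else 0) *
            w x s.2 u := by
          simp only [add_mul, Finset.sum_add_distrib, ← Finset.mul_sum, hw.sum_eq_one, mul_one,
            mul_assoc, ite_mul, one_mul, zero_mul]
      _ ≤ _ := Finset.sum_le_sum fun u _ => mul_le_mul_of_nonneg_right (by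
          split_ifs with h
          · linarith [hc _ h]
          · linarith [hb _ (hs.improve u)]) (hw.nonneg _ _)

theorem le_iterKernel_stepKernel {X : Type} {f : X → α → ℕ} {w : X → ℕ → α → ℝ} {x : X} {j : ℕ}
    (hw : IsSearch (f x) j (w x)) {g : α × ℕ → ℝ} {c : ℝ} (hc0 : 0 ≤ c) (hg : ∀ s, 0 ≤ g s)
    (hc : ∀ s, IsGood (f x) (j + 1) s → c ≤ g s) (r : ℕ) :
    (∀ s, IsGood (f x) (j + 1) s → c ≤ iterKernel (stepKernel f w) r s x g) ∧
      ∀ s, IsGood (f x) j s →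
        c * (1 - (43 / 45) ^ r) ≤ iterKernel (stepKernel f w) r s x g := by
  induction r with
  | zero => exact ⟨hc, fun s _ => by simpa [iterKernel] using hg s⟩
  | succ r ih =>
    refine ⟨fun s hs => le_stepKernel_of_isGood_succ hw ih.1 hs, fun s hs => ?_⟩
    have h1 : c * (1 - (43 / 45) ^ r) ≤ c :=
      mul_le_of_le_one_right hc0 (by linarith [pow_nonneg (by norm_num : (0 : ℝ) ≤ 43 / 45) r])
    refine le_trans (le_of_eq ?_) (le_stepKernel hw h1 ih.2 ih.1 hs)
    ring

/-- The kernels `K j, K (j + 1), …, K (j + i - 1)` in this order, where the one with `t` kernels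
to follow is iterated `32 (t + 1)` times. -/
def chainKernel {S X : Type} (K : ℕ → S → X → (S → ℝ) → ℝ) : ℕ → ℕ → S → X → (S → ℝ) → ℝ
  | 0, _, s, _, g => g s
  | i + 1, j, s, x, g =>
    iterKernel (K j) (32 * (i + 1)) s x fun s' => chainKernel K i (j + 1) s' x g

theorem chainKernel_stepKernel_nonneg {X : Type} {f : X → α → ℕ} {w : ℕ → X → ℕ → α → ℝ} {x : X}
    (hw : ∀ j, IsSearch (f x) j (w j x)) {g : α × ℕ → ℝ} (hg : ∀ s, 0 ≤ g s) (i j : ℕ)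
    (s : α × ℕ) : 0 ≤ chainKernel (fun j => stepKernel f (w j)) i j s x g := by
  induction i generalizing j s with
  | zero => exact hg s
  | succ i ih => exact iterKernel_stepKernel_nonneg (hw j).nonneg (ih (j + 1)) _ s

theorem le_chainKernel_stepKernel {X : Type} {f : X → α → ℕ} {w : ℕ → X → ℕ → α → ℝ} {x : X}
    (hw : ∀ j, IsSearch (f x) j (w j x)) {g : α × ℕ → ℝ} (hg : ∀ s, 0 ≤ g s) (i j : ℕ)
    (h : ∀ s, IsGood (f x) (j + i) s → 1 ≤ g s) {s : α × ℕ} (hs : IsGood (f x) j s) :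
    2 / 3 + 1 / 3 * (1 / 4) ^ i ≤ chainKernel (fun j => stepKernel f (w j)) i j s x g := by
  induction i generalizing j s with
  | zero => have := h s hs; simp only [chainKernel]; norm_num; exact this
  | succ i ih =>
    have h1 := (le_iterKernel_stepKernel (hw j) (by positivity)
      (chainKernel_stepKernel_nonneg hw hg i (j + 1))
      (fun s hs => ih (j + 1) (by rwa [show j + 1 + i = j + (i + 1) by omega]) hs)
      (32 * (i + 1))).2 s hs
    refine le_trans ?_ h1
    -- The count `32` is chosen so that `(43 / 45) ^ 32 ≤ 1 / 4`. With `q = (1 / 4) ^ i`, the claim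
    -- becomes `2 / 3 + q / 12 ≤ (2 / 3 + q / 3) * (1 - q / 4)`, which is `q ≤ 1`.
    have h2 : ((43 : ℝ) / 45) ^ (32 * (i + 1)) ≤ (1 / 4) ^ (i + 1) := by
      rw [pow_mul]
      exact pow_le_pow_left₀ (by positivity) (by norm_num) _
    have h3 : (0 : ℝ) ≤ (1 / 4) ^ i := by positivity
    have h4 : ((1 : ℝ) / 4) ^ i ≤ 1 := pow_le_one₀ (by norm_num) (by norm_num)
    rw [pow_succ] at h2 ⊢
    nlinarith

/-- The number of queries of a chain of kernels, the `j`-th of which makes `3 ^ j * D` queries. -/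
def chainCost (D : ℕ) : ℕ → ℕ → ℕ
  | 0, _ => 0
  | i + 1, j => 32 * (i + 1) * (3 ^ j * D) + chainCost D i (j + 1)

theorem chainCost_le (D i j : ℕ) : chainCost D i j ≤ 32 * (3 ^ (i + j) * D) := by
  -- Closed form of the arithmetic-geometric sum; it would even give the constant `24`.
  suffices h : 4 * chainCost D i j + 32 * (3 ^ j * D) * (2 * i + 3) = 96 * (3 ^ (i + j) * D) by
    have : 3 ^ j * D * 0 ≤ 3 ^ j * D * (2 * i + 3) := by positivity
    nlinarith
  induction i generalizing j with
  | zero => simp [chainCost]; ring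
  | succ i ih =>
    have h1 := ih (j + 1)
    rw [show i + 1 + j = i + (j + 1) by omega, ← h1, chainCost]
    ring

theorem realizes_chainKernel {ι S : Type} [Fintype ι] {D : ℕ}
    {K : ℕ → S → (ι → Bool) → (S → ℝ) → ℝ} (h : ∀ j, Realizes (3 ^ j * D) (K j)) (i j : ℕ) :
    Realizes (chainCost D i j) (chainKernel K i j) := by
  induction i generalizing j with
  | zero => exact realizes_pure
  | succ i ih => exact ((h j).iterKernel (32 * (i + 1))).bind (ih (j + 1))

/-- An element of maximum value among `N < 9 ^ J` elements, whose values depend on `D` bits of the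
input each, is found with `O(3 ^ J * D)` queries. -/
theorem exists_computableWith_max {ι : Type} [Fintype ι] [Nonempty α] {D J : ℕ}
    (F : α → Fin D → Option ι) (val : α → (Fin D → Bool) → ℕ) (hJ : Fintype.card α < 9 ^ J) :
    ∃ T ≤ 32 * (3 ^ J * D), ComputableWith
      (fun x v => ∀ u, val u (row F x u) ≤ val v (row F x v)) T := by
  classical
  have hk : ∀ j, ∃ k, 2 * k + 1 = 3 ^ j := fun j => by
    obtain ⟨k, hk⟩ := Odd.pow (n := j) (by decide : Odd 3)
    exact ⟨k, hk.symm⟩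
  choose k hk using hk
  choose w hw0 hw1 hlow hw using fun j => exists_realizes_search F val (k j)
  simp only [hk] at hw hlow
  have hS : ∀ x j, IsSearch (fun v => val v (row F x v)) j (w j x) := fun x j =>
    ⟨hw0 j x, hw1 j x, fun d u hu h => by
      have h9 : (3 ^ j) ^ 2 = 9 ^ j := by rw [← pow_mul, mul_comm, pow_mul]; norm_num
      have h9' : (((3 ^ j : ℕ) : ℝ)) ^ 2 = 9 ^ j := by exact_mod_cast h9
      have := hlow j x d u hu (by rwa [h9])
      rwa [h9'] at this⟩
  refine ⟨chainCost D J 0, by simpa using chainCost_le D J 0,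
    (realizes_chainKernel (K := fun j => stepKernel (fun x v => val v (row F x v)) (w j)) hw
      J 0).computableWith (Classical.arbitrary α, 0) Prod.fst fun x => ?_⟩
  -- The start `(arbitrary, 0)` is good at level `0` without any query, since `IsGood` asks only for
  -- a lower bound on the value of the stored element. At level `J` the hypothesis `N < 9 ^ J`
  -- leaves nothing above the threshold.
  refine le_trans ?_ (le_chainKernel_stepKernel (hS x) (fun s => ?_) J 0 (fun s hs => ?_)
    ⟨Nat.zero_le _, ?_⟩)
  · have : (0 : ℝ) ≤ (1 / 4) ^ J := by positivity
    linarith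
  · split_ifs <;> norm_num
  · rw [if_pos]
    intro u
    have h1 : (above (fun v => val v (row F x v)) s.2).card = 0 := by
      by_contra h
      have h2 := hs.2
      rw [zero_add] at h2
      have := Nat.mul_le_mul_left (9 ^ J) (Nat.one_le_iff_ne_zero.2 h)
      omega
    rw [Finset.card_eq_zero] at h1
    have h2 : ¬ s.2 < val u (row F x u) := fun h => by
      have := (mem_above (f := fun v => val v (row F x v))).2 h
      rw [h1] at this
      exact absurd this (Finset.notMem_empty u)
    exact (not_lt.1 h2).trans hs.1
  · simpa using Finset.card_le_univ _

end Maximum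

end QuantumQuery

/-! ### The upper bound: maximizing the out-degree -/

namespace Tournament

/-- The edges at `u`, as positions in the bit string. -/
def edgesAt {n : ℕ} (u s : Fin n) : Option (Edge n) :=
  if h : u < s then some ⟨(u, s), h⟩ else if h : s < u then some ⟨(s, u), h⟩ else none

/-- The out-degree of `u` computed from the bits of the edges at `u`. -/
def degreeOfRow {n : ℕ} (u : Fin n) (m : Fin n → Bool) : ℕ :=
  (Finset.univ.filter fun s => (u < s ∧ m s = true) ∨ (s < u ∧ m s = false)).card

theorem degreeOfRow_row {n : ℕ} (T : Edge n → Bool) (u : Fin n) :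
    degreeOfRow u (QuantumQuery.row edgesAt T u) = outDegree T u := by
  classical
  rw [degreeOfRow, outDegree]
  congr 1
  ext s
  rw [Finset.mem_filter, Finset.mem_filter]
  simp only [Finset.mem_univ, true_and, QuantumQuery.row, edgesAt]
  rcases lt_trichotomy u s with h | h | h
  · simp [arc_of_lt T h, h, h.not_gt]
  · simp [h, not_arc_self]
  · simp [arc_of_gt T h, h, h.not_gt]

theorem exists_computableWith_MOD {n : ℕ} (hn : 1 ≤ n) :
    ∃ T : ℕ, (T : ℝ) ≤ 96 * (n : ℝ) ^ (3 / 2 : ℝ) ∧ QuantumQuery.ComputableWith (MOD n) T := by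
  have : Nonempty (Fin n) := ⟨⟨0, by omega⟩⟩
  -- The search needs `n < 9 ^ (J + 1)`, while `3 ^ J ≤ √n`; the extra stage costs a factor `3`,
  -- whence `96 = 3 * 32`.
  set J := Nat.log 9 n
  obtain ⟨T, hT, h⟩ := QuantumQuery.exists_computableWith_max (J := J + 1)
    (edgesAt (n := n)) degreeOfRow
    (by rw [Fintype.card_fin]; exact Nat.lt_pow_succ_log_self (by norm_num) n)
  simp only [degreeOfRow_row] at h
  refine ⟨T, ?_, h⟩
  have h0 : (0 : ℝ) < n := by exact_mod_cast hn
  have h9 : ((9 : ℝ)) ^ J ≤ n := by exact_mod_cast Nat.pow_log_le_self 9 (by omega)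
  have h3 : (3 : ℝ) ^ J ≤ √n := by
    refine Real.le_sqrt_of_sq_le ?_
    rw [← pow_mul, mul_comm, pow_mul]
    norm_num
    exact h9
  have hpow : (n : ℝ) ^ (3 / 2 : ℝ) = n * √n := by
    rw [show (3 / 2 : ℝ) = 1 + 1 / 2 by norm_num, Real.rpow_add h0, Real.rpow_one,
      Real.sqrt_eq_rpow]
  have hT' : (T : ℝ) ≤ 32 * (3 ^ (J + 1) * n) := by exact_mod_cast hT
  rw [hpow]
  refine hT'.trans ?_
  rw [pow_succ]
  nlinarith

end Tournament

end

theorem mainTheorem5 :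
    (∃ C : ℝ≥0, ∀ n : ℕ, 1 ≤ n →
      (QuantumQuery.Q (Tournament.MOD n) : ℝ≥0∞) ≤ C * (n : ℝ≥0∞) ^ (3 / 2 : ℝ)) ∧
    (∃ c : ℝ≥0, 0 < c ∧ ∀ n : ℕ, 2 ≤ n →
      (c : ℝ≥0∞) * n ≤ (QuantumQuery.Q (Tournament.MOD n) : ℝ≥0∞)) := by
  refine ⟨⟨96, fun n hn => ?_⟩, ⟨1 / 1000, by positivity, fun n hn => ?_⟩⟩
  · obtain ⟨T, hT, h⟩ := Tournament.exists_computableWith_MOD hn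
    have h1 : (QuantumQuery.Q (Tournament.MOD n) : ℝ≥0∞) ≤ (T : ℝ≥0∞) := by
      have := ENat.toENNReal_le.2 (QuantumQuery.Q_le h)
      simpa using this
    refine h1.trans ?_
    have h2 : (T : ℝ≥0) ≤ 96 * (n : ℝ≥0) ^ (3 / 2 : ℝ) := by
      rw [← NNReal.coe_le_coe]
      push_cast
      exact hT
    have h3 := ENNReal.coe_le_coe.2 h2
    rw [ENNReal.coe_mul, ENNReal.coe_rpow_of_nonneg _ (by norm_num)] at h3
    simpa using h3
  · refine QuantumQuery.le_Q_of_forall fun T hT => ?_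
    have := Tournament.le_of_computableWith_MOD hn hT
    push_cast
    linarith
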